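/- Let $M_1,M_2$ be germs at $0$ of real analytic totally real $n$-dimensional submanifolds of $\mathbb C^n$ passing through the origin and not intersecting transversally there (that is, $T_0M_1+T_0M_2\neq\mathbb C^n$). Let $\rho_i(z)=B_i\bar z+O(|z|^2)$ be the germ of anti-holomorphic involution with fixed point set $M_i$, let $F=\rho_1\circ\rho_2$, and assume that $DF(0)=B_1\bar B_2=\operatorname{diag}(\mu_1,\dots,\mu_n)$ is diagonal. For $Q\in\mathbb N^n$ write $|Q|=\sum_j q_j$ and $\mu^Q=\prod_j\mu_j^{q_j}$, and let $e_1,\dots,e_n$ be the standard basis of $\mathbb N^n$. Assume that $\mu_1=\dots=\mu_l=1$, and let $R_1,\dots,R_p\in\mathbb N^n$ with $|R_i|>1$ and $\mu^{R_i}=1$ be the other generators of the resonance relations, in the following sense: the monoid $\{Q\in\mathbb N^n:\mu^Q=1\}$ is generated by $e_1,\dots,e_l,R_1,\dots,R_p$, and, with $\mathcal I=(z_1,\dots,z_l,z^{R_1},\dots,z^{R_p})$, every resonance $\mu^Q=\mu_j$ with $|Q|\ge2$ and $1\le j\le n$ satisfies $z^Q\in\mathcal I$. Let $V(\mathcal I)=\{z: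 z_1=\dots=z_l=z^{R_1}=\dots=z^{R_p}=0\}$. Assume that $DF(0)$ is diophantine on $V(\mathcal I)$, that is, $$-\sum_{k\ge1}\frac{\ln\omega_k}{2^k}<+\infty,\qquad \omega_k=\inf\{|\mu^Q-\mu_j|\neq0 : 2\le|Q|\le2^k,\ 1\le j\le n,\ z^Q\notin\mathcal I\},$$ with $\inf\emptyset=+\infty$. Then there are holomorphic coordinates near $0$, tangent to the identity at $0$, in which, as germs at $0$, $$M_i\cap V(\mathcal I)=\{z\in V(\mathcal I): B_i\bar z=z\},\qquad i=1,2.$$ -/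

import Mathlib

open Filter Topology

noncomputable section

/-- The value `z ^ Q = z₁ ^ q₁ ⋯ zₙ ^ qₙ` of a monomial at a point of `ℂⁿ`. -/
def monomialValue {n : ℕ} (z : Fin n → ℂ) (Q : Fin n →₀ ℕ) : ℂ :=
  ∏ j, z j ^ Q j

/-- Near the origin, `M` is a real analytic totally real submanifold of `ℂⁿ` of real dimension `n`
passing through the origin, with tangent space `T` there. It is given by a real analytic
immersion `γ` of a neighbourhood of `0` in `ℝⁿ`; the equation of filters says that the germs at `0`
of `M` and of the image of `γ` agree, and that `γ` is open onto its image there. -/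
def IsTotallyRealGerm {n : ℕ} (M : Set (Fin n → ℂ)) (T : Submodule ℝ (Fin n → ℂ)) : Prop :=
  (∃ γ : (Fin n → ℝ) → (Fin n → ℂ),
    AnalyticAt ℝ γ 0 ∧ γ 0 = 0 ∧ Function.Injective (fderiv ℝ γ 0) ∧
    LinearMap.range (fderiv ℝ γ 0 : (Fin n → ℝ) →ₗ[ℝ] (Fin n → ℂ)) = T ∧
    map γ (𝓝 0) = 𝓝[M] 0) ∧
  ∀ v ∈ T, Complex.I • v ∈ T → v = 0

/-- `ρ` represents the germ at `0` of the anti-holomorphic involution whose fixed point set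
is `M`. Here `star z` is the coordinatewise complex conjugate of `z`. -/
structure IsReflection {n : ℕ} (M : Set (Fin n → ℂ)) (ρ : (Fin n → ℂ) → (Fin n → ℂ)) : Prop where
  map_zero : ρ 0 = 0
  antiholomorphic : AnalyticAt ℂ (fun z => ρ (star z)) 0
  involutive : ∀ᶠ z in 𝓝 (0 : Fin n → ℂ), ρ (ρ z) = z
  fixed : ∀ᶠ z in 𝓝 (0 : Fin n → ℂ), ρ z = z ↔ z ∈ M

/-- The matrix of the complex derivative at the origin. -/
def linearPart {n : ℕ} (F : (Fin n → ℂ) → (Fin n → ℂ)) : Matrix (Fin n) (Fin n) ℂ :=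
  LinearMap.toMatrix' (fderiv ℂ F 0 : (Fin n → ℂ) →ₗ[ℂ] (Fin n → ℂ))

/-- The matrix `B` in the expansion `ρ z = B z̄ + O(|z|²)` of an anti-holomorphic germ. -/
def antiLinearPart {n : ℕ} (ρ : (Fin n → ℂ) → (Fin n → ℂ)) : Matrix (Fin n) (Fin n) ℂ :=
  linearPart (fun z => ρ (star z))

/-- The monomial ideal generated by the first `l` coordinates and the monomials `z ^ (R i)`.
(Only membership of monomials is used, and a monomial lies in the ideal generated by given
monomials in the ring of polynomials, of convergent, or of formal power series alike.) -/
def resonantIdeal {n p : ℕ} (l : ℕ) (R : Fin p → Fin n →₀ ℕ) : Ideal (MvPolynomial (Fin n) ℂ) :=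
  Ideal.span ({f | ∃ j : Fin n, (j : ℕ) < l ∧ f = MvPolynomial.X j} ∪
    Set.range fun i => MvPolynomial.monomial (R i) 1)

/-- The common zero set of the first `l` coordinates and the monomials `z ^ (R i)`. -/
def resonantLocus {n p : ℕ} (l : ℕ) (R : Fin p → Fin n →₀ ℕ) : Set (Fin n → ℂ) :=
  {z | (∀ j : Fin n, (j : ℕ) < l → z j = 0) ∧ ∀ i, monomialValue z (R i) = 0}

/-- `ω_k(D, 𝓘)` for `D = diag μ`: the least non-zero `|μ ^ Q - μ j|` with `2 ≤ |Q| ≤ 2 ^ k` and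
`x ^ Q ∉ 𝓘`. -/
def smallDivisor {n : ℕ} (μ : Fin n → ℂ) (I : Ideal (MvPolynomial (Fin n) ℂ)) (k : ℕ) : ℝ :=
  sInf {δ : ℝ | ∃ (Q : Fin n →₀ ℕ) (j : Fin n), 2 ≤ Q.degree ∧ Q.degree ≤ 2 ^ k ∧
    MvPolynomial.monomial Q (1 : ℂ) ∉ I ∧ δ = ‖monomialValue μ Q - μ j‖ ∧ δ ≠ 0}

/-- `diag μ` is diophantine on the ideal `I`: `- ∑_{k ≥ 1} ln ω_k / 2 ^ k < ∞`.
From some `k` on the infima are over non-empty finite sets and `ω_k` is positive and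
non-increasing (so that finiteness of the sum is summability), unless all the sets are empty;
in that case there are no small divisors, and the junk value `0` of `ω_k` makes the condition
hold, as it should. -/
def IsDiophantineOn {n : ℕ} (μ : Fin n → ℂ) (I : Ideal (MvPolynomial (Fin n) ℂ)) : Prop :=
  Summable fun k : ℕ => -Real.log (smallDivisor μ I (k + 1)) / 2 ^ (k + 1)

end

/-!
# Linearization of a pair of totally real germs on the resonant locus

Write `σᵢ z = Bᵢ z̄` for the antilinear part of `ρᵢ`, `D = diag μ = σ₁ ∘ σ₂` for the linear part of
`F = ρ₁ ∘ ρ₂`, and `V` for the resonant locus. It is enough to find `Φ` tangent to the identity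
with `ρᵢ ∘ Φ ∘ σᵢ = Φ` on `V`: since `ρᵢ` and `Φ` are injective near the origin, `Φ z` is then fixed
by `ρᵢ` exactly when `z` is fixed by `σᵢ`.

Such a `Φ` is given by any linearization of `F` on `V`, that is, any `Φ` tangent to the identity
with `F ∘ Φ = Φ ∘ D` on `V`. Indeed `F ρᵢ F = ρᵢ` and `D σᵢ D = σᵢ`, and `V` is invariant under `σᵢ`
(`mulVec_star_mem_resonantLocus`; this is where the generation of the resonance monoid is used), so
`ρᵢ ∘ Φ ∘ σᵢ` is another linearization on `V`. The set `V` is a union of coordinate subspaces. No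
monomial in the coordinates of such a subspace lies in the ideal, hence none of degree at least two
is resonant, and a linearization is unique there (`eventually_eq_of_linearizations`): the lowest
order term of the difference of two of them would be a homogeneous polynomial map commuting with
`D`.

For the existence (`BrjunoBound.exists_linearization`), `Φ` is constructed as a formal multilinear
series, that is, as a power series in noncommuting variables, whose coefficients at words
(sequences of letters) are found recursively. Beyond the linear term, only words whose letters span
a subspace of `V` are given a non-zero coefficient, so that only the divisors `μ ^ w - μ j` that the
diophantine condition controls occur. Along the recursion the inverse divisors accumulate over
trees of subwords.

Convergence rests on the counting lemma of Brjuno (`treeCost_indicator_le`): if `μ ^ w - μ j` and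
`μ ^ u - μ j` are both small, with `u` a proper subword of `w`, then `μ ^ v - 1` is small for the
complement `v` of `u`; so `v` is long, and small divisors are rare. The complement `v` together
with one letter of `u` is again a subword of `w` (`exists_subword_value`), hence again a word for
which the diophantine condition gives a bound, although admissible words are not closed under
concatenation. Summed over the scales `2 ^ k`, this bounds the product of the inverse divisors of a
tree by an exponential in the length of its root (`BrjunoBound.exists_treeCost_le`), and what is
left is the recursion of a power series without small divisors
(`exists_forall_le_pow_of_le_sum_composition`).
-/

noncomputable section

/-! ### Costs of decomposition trees -/

theorem Composition.blocksFun_lt_of_one_lt_length {m : ℕ} (c : Composition m) (hc : 1 < c.length)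
    (i : Fin c.length) : c.blocksFun i < m := by
  have hm : 0 < m := by have := c.length_le; omega
  refine (Composition.ne_single_iff hm).1 (fun h => ?_) i
  have := (Composition.eq_single_iff_length hm).1 h
  omega

/-- The largest total cost of a tree with root `w` whose nodes are words, each node being the
concatenation of its children (at least two at every inner node), when a node `u` contributes
`g u`. A word of length `m` with letters in `α` is a function `Fin m → α`. -/
def treeCost {α : Type*} (g : ∀ m, (Fin m → α) → ℝ) (m : ℕ) (w : Fin m → α) : ℝ :=
  g m w + ⨆ c : {c : Composition m // 1 < c.length},
    ∑ i : Fin c.1.length, treeCost g (c.1.blocksFun i) (w ∘ c.1.embedding i)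
termination_by m
decreasing_by exact c.1.blocksFun_lt_of_one_lt_length c.2 i

section treeCost

variable {α : Type*}

theorem sum_blocks_le_treeCost (g : ∀ m, (Fin m → α) → ℝ) {m : ℕ} (w : Fin m → α)
    (c : Composition m) (hc : 1 < c.length) :
    g m w + ∑ i, treeCost g (c.blocksFun i) (w ∘ c.embedding i) ≤ treeCost g m w := by
  conv_rhs => rw [treeCost]
  gcongr
  exact le_ciSup (f := fun c : {c : Composition m // 1 < c.length} =>
    ∑ i : Fin c.1.length, treeCost g (c.1.blocksFun i) (w ∘ c.1.embedding i))
    (Set.finite_range _).bddAbove ⟨c, hc⟩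

theorem treeCost_le (g : ∀ m, (Fin m → α) → ℝ) {m : ℕ} (w : Fin m → α) {a : ℝ} (ha : 0 ≤ a)
    (h : ∀ c : Composition m, 1 < c.length →
      ∑ i, treeCost g (c.blocksFun i) (w ∘ c.embedding i) ≤ a) :
    treeCost g m w ≤ g m w + a := by
  rw [treeCost]
  gcongr
  exact Real.iSup_le (fun c => h c.1 c.2) ha

theorem treeCost_nonneg (g : ∀ m, (Fin m → α) → ℝ) (hg : ∀ m w, 0 ≤ g m w) (m : ℕ)
    (w : Fin m → α) : 0 ≤ treeCost g m w := by
  induction m using Nat.strong_induction_on with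
  | _ m ih =>
    rw [treeCost]
    refine add_nonneg (hg _ _) (Real.iSup_nonneg fun c => Finset.sum_nonneg fun i _ => ?_)
    exact ih _ (c.1.blocksFun_lt_of_one_lt_length c.2 i) _

theorem le_treeCost (g : ∀ m, (Fin m → α) → ℝ) (hg : ∀ m w, 0 ≤ g m w) (m : ℕ)
    (w : Fin m → α) : g m w ≤ treeCost g m w := by
  rw [treeCost]
  refine le_add_of_nonneg_right (Real.iSup_nonneg fun c => Finset.sum_nonneg fun i _ => ?_)
  exact treeCost_nonneg g hg _ _

/-- The cost of trees is subadditive and positively homogeneous in the cost of nodes. -/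
theorem treeCost_le_sum {κ : Type*} (s : Finset κ) (a : κ → ℝ) (ha : ∀ k ∈ s, 0 ≤ a k)
    (g : ∀ m, (Fin m → α) → ℝ) (h : κ → ∀ m, (Fin m → α) → ℝ) (hh : ∀ k m w, 0 ≤ h k m w)
    (N : ℕ) (hgh : ∀ m ≤ N, ∀ w, g m w ≤ ∑ k ∈ s, a k * h k m w) (m : ℕ) (hm : m ≤ N)
    (w : Fin m → α) :
    treeCost g m w ≤ ∑ k ∈ s, a k * treeCost (h k) m w := by
  induction m using Nat.strong_induction_on with
  | _ m ih =>
    have hnn : 0 ≤ ∑ k ∈ s, a k * (treeCost (h k) m w - h k m w) :=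
      Finset.sum_nonneg fun k hk => mul_nonneg (ha k hk) (sub_nonneg.2 (le_treeCost _ (hh k) _ _))
    refine (treeCost_le g w hnn fun c hc => ?_).trans
      ((add_le_add_left (hgh m hm w) _).trans_eq ?_)
    · calc
        ∑ i, treeCost g (c.blocksFun i) (w ∘ c.embedding i)
            ≤ ∑ i, ∑ k ∈ s, a k * treeCost (h k) (c.blocksFun i) (w ∘ c.embedding i) :=
          Finset.sum_le_sum fun i _ => ih _ (c.blocksFun_lt_of_one_lt_length hc i)
            ((c.blocksFun_le i).trans hm) _
        _ = ∑ k ∈ s, a k * ∑ i, treeCost (h k) (c.blocksFun i) (w ∘ c.embedding i) := by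
          rw [Finset.sum_comm]; simp_rw [Finset.mul_sum]
        _ ≤ _ := by
          refine Finset.sum_le_sum fun k hk => mul_le_mul_of_nonneg_left ?_ (ha k hk)
          have := sum_blocks_le_treeCost (h k) w c hc
          linarith
    · rw [← Finset.sum_add_distrib]
      exact Finset.sum_congr rfl fun k _ => by ring

/-- If each part of a composition costs at most `max 0 (2 * size / M - 1)`, then either a single
part carries the whole cost, or the total is at most `2 * total size / M - 2`. -/
theorem Composition.sum_le_or_single {m : ℕ} (c : Composition m) (hc : 0 < c.length) {M : ℝ}
    (hM : 0 < M) (t : Fin c.length → ℝ)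
    (ht : ∀ i, t i ≤ max 0 (2 * (c.blocksFun i : ℝ) / M - 1)) :
    (∃ i, ∑ i', t i' ≤ max 0 (t i)) ∨ ∑ i, t i ≤ 2 * (m : ℝ) / M - 2 := by
  by_cases h : ∃ i i', i ≠ i' ∧ 0 < t i ∧ 0 < t i'
  · right
    obtain ⟨i, i', hii, hi, hi'⟩ := h
    have key : ∀ k, t k ≤ 2 * (c.blocksFun k : ℝ) / M -
        ((if k = i then 1 else 0) + if k = i' then 1 else 0) := by
      intro k
      have hk := ht k
      have hpos : 0 ≤ 2 * (c.blocksFun k : ℝ) / M := by positivity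
      by_cases h1 : k = i
      · subst h1
        rw [if_pos rfl, if_neg hii]
        rcases le_max_iff.1 hk with h | h <;> linarith
      · by_cases h2 : k = i'
        · subst h2
          rw [if_pos rfl, if_neg h1]
          rcases le_max_iff.1 hk with h | h <;> linarith
        · rw [if_neg h1, if_neg h2]
          rcases le_max_iff.1 hk with h | h <;> linarith
    refine (Finset.sum_le_sum fun k _ => key k).trans_eq ?_
    rw [Finset.sum_sub_distrib, Finset.sum_add_distrib]
    simp only [Finset.sum_ite_eq', Finset.mem_univ, if_true]
    rw [← Finset.sum_div, ← Finset.mul_sum]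
    have : (∑ k, (c.blocksFun k : ℝ)) = m := by exact_mod_cast c.sum_blocksFun
    rw [this]; norm_num
  · left
    push Not at h
    by_cases h0 : ∃ i, 0 < t i
    · obtain ⟨i, hi⟩ := h0
      refine ⟨i, le_max_of_le_right ?_⟩
      rw [← Finset.add_sum_erase _ _ (Finset.mem_univ i)]
      have : ∑ k ∈ Finset.univ.erase i, t k ≤ 0 :=
        Finset.sum_nonpos fun k hk => h i k (Finset.ne_of_mem_erase hk).symm hi
      linarith
    · push Not at h0
      exact ⟨⟨0, hc⟩, le_max_of_le_left (Finset.sum_nonpos fun k _ => h0 k)⟩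

open Classical in
/-- The counting lemma of Brjuno. If the words of a class are longer than `M`, and a word of the
class which is a proper subword of another one is shorter by at least `M`, then a tree with root of
length `m` has at most `max 0 (2 * m / M - 1)` nodes in the class. -/
theorem treeCost_indicator_le (small : ∀ m, (Fin m → α) → Prop) {M : ℕ} (hM : 0 < M)
    (hlen : ∀ m w, small m w → M < m)
    (hsep : ∀ m w m' (f : Fin m' → Fin m), Function.Injective f → m' < m → small m w →
      small m' (w ∘ f) → m' + M ≤ m) (m : ℕ) (w : Fin m → α) :
    treeCost (fun m w => if small m w then 1 else 0) m w ≤ max 0 (2 * (m : ℝ) / M - 1) := by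
  have hM' : (0 : ℝ) < M := by exact_mod_cast hM
  induction m using Nat.strong_induction_on with
  | _ m A =>
    -- Below a word of the class the bound improves by one: a node longer than `m - M` is not in the
    -- class, and a node of length at most `m - M` has the bound for its own length.
    have B : small m w → ∀ m' (f : Fin m' → Fin m), Function.Injective f → m' < m →
        treeCost (fun m w => if small m w then 1 else 0) m' (w ∘ f) ≤ 2 * (m : ℝ) / M - 2 := by
      intro hw m'
      have hmM : (M : ℝ) < m := by exact_mod_cast hlen m w hw
      have h2 : 0 ≤ 2 * (m : ℝ) / M - 2 := by
        rw [sub_nonneg, le_div_iff₀ hM']; linarith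
      induction m' using Nat.strong_induction_on with
      | _ m' ih =>
        intro f hf hm'
        by_cases hle : m' + M ≤ m
        · refine (A m' hm' _).trans (max_le h2 ?_)
          have : (m' : ℝ) + M ≤ m := by exact_mod_cast hle
          have h3 : 2 * (m' : ℝ) / M ≤ 2 * (m : ℝ) / M - 2 := by
            rw [div_le_iff₀ hM', sub_mul, div_mul_cancel₀ _ hM'.ne']; linarith
          linarith
        · have hns : ¬ small m' (w ∘ f) := fun h => hle (hsep m w m' f hf hm' hw h)
          refine (treeCost_le _ _ h2 fun c hc => ?_).trans_eq (by rw [if_neg hns, zero_add])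
          have hlt := c.blocksFun_lt_of_one_lt_length hc
          rcases c.sum_le_or_single (by omega) hM' _
            (fun i => A _ ((hlt i).trans hm') ((w ∘ f) ∘ c.embedding i)) with ⟨i, h⟩ | h
          · exact h.trans (max_le h2 (ih _ (hlt i) (f ∘ c.embedding i)
              (hf.comp (c.embedding i).injective) ((hlt i).trans hm')))
          · refine h.trans ?_
            gcongr
    by_cases hw : small m w
    · have hmM : (M : ℝ) < m := by exact_mod_cast hlen m w hw
      have h2 : 0 ≤ 2 * (m : ℝ) / M - 2 := by
        rw [sub_nonneg, le_div_iff₀ hM']; linarith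
      refine le_max_of_le_right ((treeCost_le _ _ h2 fun c hc => ?_).trans_eq ?_)
      · have hlt := c.blocksFun_lt_of_one_lt_length hc
        rcases c.sum_le_or_single (by omega) hM' _
          (fun i => A _ (hlt i) (w ∘ c.embedding i)) with ⟨i, h⟩ | h
        · exact h.trans (max_le h2 (B hw _ _ (c.embedding i).injective (hlt i)))
        · exact h
      · rw [if_pos hw]; ring
    · refine (treeCost_le _ _ (le_max_left _ _) fun c hc => ?_).trans_eq
        (by rw [if_neg hw, zero_add])
      have hlt := c.blocksFun_lt_of_one_lt_length hc
      rcases c.sum_le_or_single (by omega) hM' _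
        (fun i => A _ (hlt i) (w ∘ c.embedding i)) with ⟨i, h⟩ | h
      · refine h.trans (max_le (le_max_left _ _) ((A _ (hlt i) _).trans ?_))
        have : (c.blocksFun i : ℝ) ≤ m := by exact_mod_cast c.blocksFun_le i
        gcongr
      · exact h.trans (le_max_of_le_right (by linarith))

end treeCost

/-! ### Recursive bounds over compositions -/

/-- Solutions of the recursive inequality satisfied by the coefficients of an implicitly defined
power series grow at most geometrically. -/
theorem exists_forall_le_pow_of_le_sum_composition {t : ℕ → ℝ} (ht : ∀ m, 0 ≤ t m) {C r : ℝ}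
    (hC : 0 < C) (hr : 0 < r) (h1 : t 1 ≤ 1)
    (hrec : ∀ m, 2 ≤ m → t m ≤ ∑ c ∈ ({c | 1 < Composition.length c}.toFinset :
      Finset (Composition m)), C * r ^ c.length * ∏ i, t (c.blocksFun i)) :
    ∃ K : ℝ, 0 < K ∧ ∀ m, 1 ≤ m → t m ≤ K ^ m := by
  obtain ⟨a, apos, a1, ha1, ha2⟩ : ∃ a : ℝ, 0 < a ∧ 2 * a ≤ 1 ∧ 8 * C * r ^ 2 * a ≤ 1 ∧
      r * 2 * a ≤ 1 / 2 := by
    refine ⟨min (1 / 2) (min (1 / (8 * C * r ^ 2)) (1 / (4 * r))), by positivity, ?_, ?_, ?_⟩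
    · have := min_le_left (1 / 2 : ℝ) (min (1 / (8 * C * r ^ 2)) (1 / (4 * r)))
      linarith
    · calc
        _ ≤ 8 * C * r ^ 2 * (1 / (8 * C * r ^ 2)) := by
          gcongr
          exact (min_le_right _ _).trans (min_le_left _ _)
        _ = 1 := by field_simp
        _ ≤ 1 := le_rfl
    · calc
        _ ≤ r * 2 * (1 / (4 * r)) := by
          gcongr
          exact (min_le_right _ _).trans (min_le_right _ _)
        _ = 1 / 2 := by field_simp; norm_num
        _ ≤ 1 / 2 := le_rfl
  -- The partial sums satisfy `S (n + 1) ≤ a + C * ∑ k ≥ 2, (r * S n) ^ k`, and `a` is small enough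
  -- for `S n ≤ 2 * a` to be preserved.
  let S : ℕ → ℝ := fun n => ∑ k ∈ Finset.Ico 1 n, a ^ k * t k
  have hS : ∀ n, 1 ≤ n → S n ≤ 2 * a := by
    apply Nat.le_induction
    · simp only [S, Finset.Ico_self, Finset.sum_empty]
      positivity
    · intro n hn ih
      have hS0 : 0 ≤ S n := Finset.sum_nonneg fun k _ => mul_nonneg (by positivity) (ht k)
      have rS : r * S n ≤ 1 / 2 := by
        calc
          r * S n ≤ r * (2 * a) := by gcongr
          _ ≤ 1 / 2 := by linarith
      have In : 2 ≤ n + 1 := by omega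
      calc
        S (n + 1) = a * t 1 + ∑ k ∈ Finset.Ico 2 (n + 1), a ^ k * t k := by
          simp only [S]
          rw [Finset.sum_eq_sum_Ico_succ_bot (by omega)]
          simp
        _ ≤ a * 1 + ∑ k ∈ Finset.Ico 2 (n + 1), a ^ k *
            ∑ c ∈ ({c | 1 < Composition.length c}.toFinset : Finset (Composition k)),
              C * r ^ c.length * ∏ i, t (c.blocksFun i) := by
          gcongr with k hk
          exact hrec k (Finset.mem_Ico.1 hk).1
        _ = a + C * ∑ k ∈ Finset.Ico 2 (n + 1), a ^ k *
            ∑ c ∈ ({c | 1 < Composition.length c}.toFinset : Finset (Composition k)),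
              r ^ c.length * ∏ i, t (c.blocksFun i) := by
          rw [mul_one, Finset.mul_sum]
          congr 1
          refine Finset.sum_congr rfl fun k _ => ?_
          rw [mul_left_comm]
          simp_rw [Finset.mul_sum, mul_assoc]
        _ ≤ a + C * ∑ k ∈ Finset.Ico 2 (n + 1), (r * S n) ^ k := by
          refine add_le_add_right (mul_le_mul_of_nonneg_left ?_ hC.le) a
          simp_rw [mul_pow]
          exact FormalMultilinearSeries.radius_right_inv_pos_of_radius_pos_aux1 n t ht hr.le apos.le
        _ = a + C * (((r * S n) ^ 2 - (r * S n) ^ (n + 1)) / (1 - r * S n)) := by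
          rw [geom_sum_Ico' _ In]; exact ne_of_lt (rS.trans_lt (by norm_num))
        _ ≤ a + C * ((r * S n) ^ 2 / (1 / 2)) := by
          gcongr
          · simp only [sub_le_self_iff]
            positivity
          · linarith only [rS]
        _ ≤ a + C * ((r * (2 * a)) ^ 2 / (1 / 2)) := by gcongr
        _ = a + (8 * C * r ^ 2 * a) * a := by ring
        _ ≤ a + 1 * a := by gcongr
        _ = 2 * a := by ring
  refine ⟨a⁻¹, by positivity, fun m hm => ?_⟩
  have h : a ^ m * t m ≤ 1 := by
    refine (?_ : _ ≤ S (m + 1)).trans ((hS _ (by omega)).trans a1)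
    exact Finset.single_le_sum (f := fun k => a ^ k * t k)
      (fun k _ => mul_nonneg (by positivity) (ht k)) (by simp [hm])
  rw [inv_pow, ← one_div, le_div_iff₀ (by positivity)]
  linarith

/-! ### Small divisors along a tree -/

/-- The value of the noncommutative monomial `w` at `μ`. -/
def wordValue {n m : ℕ} (μ : Fin n → ℂ) (w : Fin m → Fin n) : ℂ :=
  ∏ i, μ (w i)

/-- A family of sets of letters, closed under taking subsets, together with lower bounds `ω k` for
the divisors `μ ^ w - μ j` of the words `w` of length at most `2 ^ k` with letters in one of these
sets; the bounds satisfy the condition of Brjuno. -/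
structure BrjunoBound {n : ℕ} (μ : Fin n → ℂ) (adm : Finset (Fin n) → Prop) (ω : ℕ → ℝ) :
    Prop where
  ne_zero : ∀ j, μ j ≠ 0
  mono : ∀ S S', S ⊆ S' → adm S' → adm S
  pos : ∀ k, 0 < ω k
  le_one : ∀ k, ω k ≤ 1
  summable : Summable fun k => -Real.log (ω (k + 1)) / 2 ^ (k + 1)
  le_divisor : ∀ k, 1 ≤ k → ∀ m (w : Fin m → Fin n), 2 ≤ m → m ≤ 2 ^ k →
    adm (Finset.univ.image w) → ∀ j, ω k ≤ ‖wordValue μ w - μ j‖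

/-- If `U * V` and `U` are both close to `x`, then `V` is close to `1`. -/
theorem norm_mul_sub_lt_of_norm_sub_lt {a b θ ε : ℝ} {U V x y : ℂ} (ha : 0 < a) (hb : 0 < b)
    (hθ : 0 < θ) (hθa : θ ≤ a / 2) (hθb : θ ≤ a / (4 * b)) (hε : 0 < ε) (hε1 : ε ≤ 1)
    (hx : a ≤ ‖x‖) (hy : ‖y‖ ≤ b) (hUV : ‖U * V - x‖ < θ * ε) (hU : ‖U - x‖ < θ * ε) :
    ‖V * y - y‖ < ε := by
  have hθε : θ * ε ≤ a / 2 := (mul_le_of_le_one_right hθ.le hε1).trans hθa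
  have hUa : a / 2 ≤ ‖U‖ := by
    have := norm_sub_norm_le x (x - U)
    rw [norm_sub_rev x U, sub_sub_cancel] at this
    linarith
  have h1 : ‖U‖ * ‖V - 1‖ < 2 * (θ * ε) := by
    rw [← norm_mul]
    calc
      ‖U * (V - 1)‖ = ‖(U * V - x) - (U - x)‖ := by congr 1; ring
      _ ≤ _ := norm_sub_le _ _
      _ < _ := by linarith
  have h2 : a / 2 * ‖V - 1‖ < 2 * (θ * ε) :=
    (mul_le_mul_of_nonneg_right hUa (norm_nonneg _)).trans_lt h1
  have h3 : θ * (4 * b) ≤ a := by rwa [le_div_iff₀ (by positivity)] at hθb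
  have h4 : ‖V * y - y‖ ≤ ‖V - 1‖ * b := by
    rw [← sub_one_mul, norm_mul]
    exact mul_le_mul_of_nonneg_left hy (norm_nonneg _)
  refine h4.trans_lt (lt_of_mul_lt_mul_left (a := a) ?_ ha.le)
  calc
    a * (‖V - 1‖ * b) = (a / 2 * ‖V - 1‖) * (2 * b) := by ring
    _ < 2 * (θ * ε) * (2 * b) := by gcongr
    _ = θ * (4 * b) * ε := by ring
    _ ≤ a * ε := by gcongr

/-- A word splits as a product of a subword `u` and its complement. Together with one letter of
`u`, the complement is again a subword. -/
theorem exists_subword_value {n m m' : ℕ} (μ : Fin n → ℂ) (w : Fin m → Fin n) (f : Fin m' → Fin m)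
    (hf : Function.Injective f) (hm' : 0 < m') :
    ∃ (g : Fin (m - m' + 1) → Fin m) (V : ℂ) (j : Fin n),
      wordValue μ w = wordValue μ (w ∘ f) * V ∧ wordValue μ (w ∘ g) = V * μ j := by
  classical
  let A : Finset (Fin m) := Finset.univ.image f
  have hA : A.card = m' := by simp [A, Finset.card_image_of_injective _ hf]
  have h0 : f ⟨0, hm'⟩ ∉ Aᶜ := by simp [A]
  have hT : (insert (f ⟨0, hm'⟩) Aᶜ).card = m - m' + 1 := by
    rw [Finset.card_insert_of_notMem h0, Finset.card_compl, hA, Fintype.card_fin]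
  refine ⟨(insert (f ⟨0, hm'⟩) Aᶜ).orderEmbOfFin hT, ∏ i ∈ Aᶜ, μ (w i), w (f ⟨0, hm'⟩), ?_, ?_⟩
  · rw [wordValue, wordValue, ← Finset.prod_mul_prod_compl A, Finset.prod_image hf.injOn]
    rfl
  · rw [wordValue, mul_comm, ← Finset.prod_insert (f := fun i => μ (w i)) h0]
    conv_rhs => rw [← Finset.image_orderEmbOfFin_univ _ hT]
    rw [Finset.prod_image (RelEmbedding.injective _).injOn]
    rfl

section BrjunoBound

variable {n : ℕ} {μ : Fin n → ℂ} {adm : Finset (Fin n) → Prop} {ω : ℕ → ℝ}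

open Classical in
/-- The logarithmic contribution of the divisor `μ ^ w - μ j`, up to the normalisation `θ`. -/
def divisorCost (μ : Fin n → ℂ) (adm : Finset (Fin n) → Prop) (θ : ℝ) (j : Fin n) (m : ℕ)
    (w : Fin m → Fin n) : ℝ :=
  if 2 ≤ m ∧ adm (Finset.univ.image w) then max 0 (Real.log (θ / ‖wordValue μ w - μ j‖)) else 0

/-- The words whose divisor is not bounded below by `θ * ω k`. At level `0` this means all words of
length at least two. -/
def IsSmallWord (μ : Fin n → ℂ) (adm : Finset (Fin n) → Prop) (ω : ℕ → ℝ) (θ : ℝ) (j : Fin n)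
    (k m : ℕ) (w : Fin m → Fin n) : Prop :=
  2 ≤ m ∧ adm (Finset.univ.image w) ∧ (k ≠ 0 → ‖wordValue μ w - μ j‖ < θ * ω k)

theorem divisorCost_nonneg (θ : ℝ) (j : Fin n) (m : ℕ) (w : Fin m → Fin n) :
    0 ≤ divisorCost μ adm θ j m w := by
  rw [divisorCost]; split_ifs <;> simp

open Classical in
/-- If `K ≥ 1` is the first level at which `θ * ω K` bounds the divisor from below, then the cost is
at most `-log (ω K)`, and the word is small at level `K - 1`. -/
theorem BrjunoBound.divisorCost_le_sum (h : BrjunoBound μ adm ω) {θ : ℝ} (hθ : 0 < θ)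
    (hθ1 : θ ≤ 1) (j : Fin n) {N m : ℕ} (hm : m ≤ N) (w : Fin m → Fin n) :
    divisorCost μ adm θ j m w ≤ ∑ k ∈ Finset.range N, -Real.log (ω (k + 1)) *
      if IsSmallWord μ adm ω θ j k m w then 1 else 0 := by
  have hlog : ∀ k, 0 ≤ -Real.log (ω k) := fun k =>
    neg_nonneg.2 (Real.log_nonpos (h.pos k).le (h.le_one k))
  rw [divisorCost]
  split_ifs with hw
  · have hex : ∃ K, 1 ≤ K ∧ θ * ω K ≤ ‖wordValue μ w - μ j‖ := by
      refine ⟨N, by omega, (mul_le_of_le_one_left (h.pos N).le hθ1).trans ?_⟩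
      exact h.le_divisor N (by omega) m w hw.1 (hm.trans Nat.lt_two_pow_self.le) hw.2 j
    let K := Nat.find hex
    have hK : 1 ≤ K ∧ θ * ω K ≤ ‖wordValue μ w - μ j‖ := Nat.find_spec hex
    have hKN : K ≤ N := Nat.find_min' hex
      ⟨by omega, (mul_le_of_le_one_left (h.pos N).le hθ1).trans
        (h.le_divisor N (by omega) m w hw.1 (hm.trans Nat.lt_two_pow_self.le) hw.2 j)⟩
    have hsm : IsSmallWord μ adm ω θ j (K - 1) m w := by
      refine ⟨hw.1, hw.2, fun h0 => ?_⟩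
      by_contra hlt
      exact Nat.find_min hex (m := K - 1) (by omega) ⟨by omega, not_lt.1 hlt⟩
    have hle : -Real.log (ω (K - 1 + 1)) *
        (if IsSmallWord μ adm ω θ j (K - 1) m w then 1 else 0) ≤
        ∑ k ∈ Finset.range N, -Real.log (ω (k + 1)) *
          if IsSmallWord μ adm ω θ j k m w then 1 else 0 :=
      Finset.single_le_sum (f := fun k => -Real.log (ω (k + 1)) *
          if IsSmallWord μ adm ω θ j k m w then 1 else 0)
        (fun k _ => mul_nonneg (hlog _) (by split_ifs <;> simp))
        (Finset.mem_range.2 (by omega))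
    refine le_trans ?_ hle
    rw [if_pos hsm, mul_one, Nat.sub_add_cancel hK.1]
    refine max_le (hlog K) ?_
    have hpos : 0 < ‖wordValue μ w - μ j‖ := (mul_pos hθ (h.pos K)).trans_le hK.2
    rw [← Real.log_inv]
    refine Real.log_le_log (by positivity) ?_
    rw [div_le_iff₀ hpos, ← div_eq_inv_mul, le_div_iff₀ (h.pos K)]
    exact hK.2
  · exact Finset.sum_nonneg fun k _ => mul_nonneg (hlog _) (by split_ifs <;> simp)

theorem BrjunoBound.isSmallWord_length (h : BrjunoBound μ adm ω) {θ : ℝ} (hθ1 : θ ≤ 1) (j : Fin n)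
    (k m : ℕ) (w : Fin m → Fin n) (hw : IsSmallWord μ adm ω θ j k m w) : 2 ^ k < m := by
  by_contra hlt
  rcases Nat.eq_zero_or_pos k with rfl | hk
  · have := hw.1; simp at hlt; omega
  · refine (hw.2.2 hk.ne').not_ge ((mul_le_of_le_one_left (h.pos k).le hθ1).trans ?_)
    exact h.le_divisor k hk m w hw.1 (not_lt.1 hlt) hw.2.1 j

/-- A proper subword of a small word `w` which is also small is shorter than `w` by `2 ^ k`. -/
theorem BrjunoBound.isSmallWord_separated (h : BrjunoBound μ adm ω) {a b θ : ℝ} (ha : 0 < a)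
    (hb : 0 < b) (hμa : ∀ j, a ≤ ‖μ j‖) (hμb : ∀ j, ‖μ j‖ ≤ b) (hθ : 0 < θ)
    (hθa : θ ≤ a / 2) (hθb : θ ≤ a / (4 * b)) (j : Fin n) (k : ℕ) (m : ℕ)
    (w : Fin m → Fin n) (m' : ℕ) (f : Fin m' → Fin m) (hf : Function.Injective f) (hm' : m' < m)
    (hw : IsSmallWord μ adm ω θ j k m w) (hu : IsSmallWord μ adm ω θ j k m' (w ∘ f)) :
    m' + 2 ^ k ≤ m := by
  rcases Nat.eq_zero_or_pos k with rfl | hk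
  · simpa using hm'
  · obtain ⟨g, V, i, hV, hg⟩ := exists_subword_value μ w f hf (by have := hu.1; omega)
    by_contra hlt
    have hadm : adm (Finset.univ.image (w ∘ g)) := by
      refine h.mono _ _ ?_ hw.2.1
      intro x hx
      obtain ⟨y, -, rfl⟩ := Finset.mem_image.1 hx
      exact Finset.mem_image_of_mem _ (Finset.mem_univ _)
    have h1 := h.le_divisor k hk _ (w ∘ g) (by omega) (by omega) hadm i
    rw [hg] at h1
    have h2 := hw.2.2 hk.ne'
    rw [hV] at h2
    exact h1.not_gt (norm_mul_sub_lt_of_norm_sub_lt ha hb hθ hθa hθb (h.pos k) (h.le_one k)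
      (hμa j) (hμb i) h2 (hu.2.2 hk.ne'))

/-- Under the condition of Brjuno, the product of all inverse divisors along a tree is at most
exponential in the length of the root. -/
theorem BrjunoBound.exists_treeCost_le (h : BrjunoBound μ adm ω) :
    ∃ θ B : ℝ, 0 < θ ∧ 0 ≤ B ∧ ∀ j m (w : Fin m → Fin n),
      treeCost (divisorCost μ adm θ j) m w ≤ B * m := by
  classical
  have hlog : ∀ k, 0 ≤ -Real.log (ω k) := fun k =>
    neg_nonneg.2 (Real.log_nonpos (h.pos k).le (h.le_one k))
  obtain ⟨a, ha, hμa⟩ : ∃ a : ℝ, 0 < a ∧ ∀ j, a ≤ ‖μ j‖ := by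
    rcases isEmpty_or_nonempty (Fin n) with hn | hn
    · exact ⟨1, one_pos, fun j => hn.elim j⟩
    · obtain ⟨i, hi⟩ := Finite.exists_min fun j => ‖μ j‖
      exact ⟨‖μ i‖, norm_pos_iff.2 (h.ne_zero i), hi⟩
  have hμb : ∀ j, ‖μ j‖ ≤ ‖μ‖ + 1 := fun j => (norm_le_pi_norm μ j).trans (by linarith)
  have hb : 0 < ‖μ‖ + 1 := by positivity
  -- The normalisation needed to compare the divisors of a word and of a subword.
  let θ := min 1 (min (a / 2) (a / (4 * (‖μ‖ + 1))))
  have hθ : 0 < θ := by positivity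
  have hθ1 : θ ≤ 1 := min_le_left _ _
  have hθa : θ ≤ a / 2 := (min_le_right _ _).trans (min_le_left _ _)
  have hθb : θ ≤ a / (4 * (‖μ‖ + 1)) := (min_le_right _ _).trans (min_le_right _ _)
  let Λ := ∑' k, -Real.log (ω (k + 1)) / 2 ^ (k + 1)
  have hterm : ∀ k, 0 ≤ -Real.log (ω (k + 1)) / 2 ^ (k + 1) :=
    fun k => div_nonneg (hlog _) (by positivity)
  refine ⟨θ, 4 * Λ, hθ, mul_nonneg (by norm_num) (tsum_nonneg hterm), fun j m w => ?_⟩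
  calc
    treeCost (divisorCost μ adm θ j) m w
        ≤ ∑ k ∈ Finset.range m, -Real.log (ω (k + 1)) * treeCost
          (fun m w => if IsSmallWord μ adm ω θ j k m w then 1 else 0) m w :=
      treeCost_le_sum (Finset.range m) (fun k => -Real.log (ω (k + 1))) (fun k _ => hlog _) _
        (fun k m w => if IsSmallWord μ adm ω θ j k m w then 1 else 0)
        (fun k m w => by split_ifs <;> simp) m
        (fun m' hm' w => h.divisorCost_le_sum hθ hθ1 j hm' w) m le_rfl w
    _ ≤ ∑ k ∈ Finset.range m, -Real.log (ω (k + 1)) * (2 * (m : ℝ) / 2 ^ k) := by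
      refine Finset.sum_le_sum fun k _ => mul_le_mul_of_nonneg_left ?_ (hlog _)
      refine (treeCost_indicator_le (IsSmallWord μ adm ω θ j k) (M := 2 ^ k) (by positivity)
        (h.isSmallWord_length hθ1 j k)
        (h.isSmallWord_separated ha hb hμa hμb hθ hθa hθb j k) m w).trans ?_
      push_cast
      exact max_le (by positivity) (by linarith)
    _ = 4 * (∑ k ∈ Finset.range m, -Real.log (ω (k + 1)) / 2 ^ (k + 1)) * m := by
      rw [Finset.mul_sum, Finset.sum_mul]
      refine Finset.sum_congr rfl fun k _ => ?_
      rw [pow_succ]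
      field_simp
      ring
    _ ≤ 4 * Λ * m := by
      gcongr
      exact h.summable.sum_le_tsum _ fun k _ => hterm k

end BrjunoBound

/-! ### Power series prescribed on words -/

section ofWords

variable {n : ℕ}

/-- The formal power series in `n` noncommuting variables whose coefficient at the word `w` of
length `m` is `a m w`. -/
def FormalMultilinearSeries.ofWords (a : ∀ m, (Fin m → Fin n) → (Fin n → ℂ)) :
    FormalMultilinearSeries ℂ (Fin n → ℂ) (Fin n → ℂ) := fun m =>
  ∑ w : Fin m → Fin n, ((ContinuousMultilinearMap.mkPiAlgebra ℂ (Fin m) ℂ).compContinuousLinearMap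
    fun i => ContinuousLinearMap.proj (w i)).smulRight (a m w)

theorem FormalMultilinearSeries.ofWords_apply (a : ∀ m, (Fin m → Fin n) → (Fin n → ℂ)) (m : ℕ)
    (v : Fin m → Fin n → ℂ) :
    ofWords a m v = ∑ w : Fin m → Fin n, (∏ i, v i (w i)) • a m w := by
  simp [ofWords]

theorem FormalMultilinearSeries.ofWords_apply_smul_single
    (a : ∀ m, (Fin m → Fin n) → (Fin n → ℂ)) (m : ℕ) (c : Fin m → ℂ) (w : Fin m → Fin n) :
    ofWords a m (fun i => c i • Pi.single (w i) 1) = (∏ i, c i) • a m w := by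
  rw [ofWords_apply, Finset.sum_eq_single w]
  · simp
  · intro u _ hu
    obtain ⟨i, hi⟩ := Function.ne_iff.1 hu
    rw [Finset.prod_eq_zero (Finset.mem_univ i), zero_smul]
    simp [Pi.single_eq_of_ne hi]
  · simp

theorem FormalMultilinearSeries.ofWords_apply_single
    (a : ∀ m, (Fin m → Fin n) → (Fin n → ℂ)) (m : ℕ) (w : Fin m → Fin n) :
    ofWords a m (fun i => Pi.single (w i) 1) = a m w := by
  simpa using ofWords_apply_smul_single a m (fun _ => 1) w

theorem FormalMultilinearSeries.radius_ofWords_pos {a : ∀ m, (Fin m → Fin n) → (Fin n → ℂ)}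
    {K : ℝ} (hK : 0 < K) (ha : ∀ m, 1 ≤ m → ∀ w, ‖a m w‖ ≤ K ^ m) : 0 < (ofWords a).radius := by
  let r : NNReal := ⟨(n * K + 1)⁻¹, by positivity⟩
  refine lt_of_lt_of_le (b := (r : ENNReal)) ?_ (le_radius_of_eventually_le _ 1 ?_)
  · rw [ENNReal.coe_pos, ← NNReal.coe_pos]
    change 0 < (n * K + 1)⁻¹
    positivity
  · filter_upwards [eventually_ge_atTop 1] with m hm
    have h1 : ‖ofWords a m‖ ≤ (n * K) ^ m := by
      refine ContinuousMultilinearMap.opNorm_le_bound (by positivity) fun v => ?_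
      rw [ofWords_apply]
      calc
        _ ≤ ∑ w : Fin m → Fin n, (∏ i, ‖v i‖) * K ^ m := by
          refine norm_sum_le_of_le _ fun w _ => ?_
          rw [norm_smul, norm_prod]
          gcongr with i
          · exact norm_le_pi_norm _ _
          · exact ha m hm w
        _ = _ := by simp [mul_pow]; ring
    calc
      ‖ofWords a m‖ * (r : ℝ) ^ m ≤ (n * K) ^ m * ((n * K + 1)⁻¹) ^ m := by
        gcongr; exact le_rfl
      _ = (n * K / (n * K + 1)) ^ m := by rw [← mul_pow, div_eq_mul_inv]
      _ ≤ 1 := by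
        refine pow_le_one₀ (by positivity) ?_
        rw [div_le_one (by positivity)]; linarith

theorem ContinuousMultilinearMap.apply_const_eq_sum_words {m : ℕ} {E : Type*}
    [NormedAddCommGroup E] [NormedSpace ℂ E]
    (T : ContinuousMultilinearMap ℂ (fun _ : Fin m => Fin n → ℂ) E) (z : Fin n → ℂ) :
    T (fun _ => z) = ∑ w : Fin m → Fin n, wordValue z w • T (fun i => Pi.single (w i) 1) := by
  have hz : z = ∑ j, z j • (Pi.single j 1 : Fin n → ℂ) := by
    simpa using (pi_eq_sum_univ' z)
  conv_lhs => rw [hz]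
  rw [T.map_sum]
  exact Finset.sum_congr rfl fun w _ => T.map_smul_univ _ _

end ofWords

/-! ### The linearizing power series -/

section Linearization

variable {n : ℕ}

open Classical in
/-- The coefficient at the word `w` of the solution of `F ∘ Φ = Φ ∘ diag μ`, where `p` is the power
series of `F`; for words of length other than one it is set to zero unless the set of letters of `w`
is admissible. -/
def linearizingCoeff (p : FormalMultilinearSeries ℂ (Fin n → ℂ) (Fin n → ℂ)) (μ : Fin n → ℂ)
    (adm : Finset (Fin n) → Prop) (m : ℕ) (w : Fin m → Fin n) : Fin n → ℂ :=
  if h : m = 1 then Pi.single (w ⟨0, by omega⟩) 1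
  else if adm (Finset.univ.image w) then fun j => (wordValue μ w - μ j)⁻¹ *
    (∑ c ∈ ({c | 1 < Composition.length c}.toFinset : Finset (Composition m)),
      p c.length fun i => if c.blocksFun i < m then
        linearizingCoeff p μ adm (c.blocksFun i) (w ∘ c.embedding i) else 0) j
  else 0
termination_by m

variable (p : FormalMultilinearSeries ℂ (Fin n → ℂ) (Fin n → ℂ)) (μ : Fin n → ℂ)
    (adm : Finset (Fin n) → Prop)

theorem linearizingCoeff_one (w : Fin 1 → Fin n) :
    linearizingCoeff p μ adm 1 w = Pi.single (w 0) 1 := by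
  rw [linearizingCoeff, dif_pos rfl]; rfl

theorem linearizingCoeff_of_not_adm {m : ℕ} (hm : m ≠ 1) (w : Fin m → Fin n)
    (hw : ¬ adm (Finset.univ.image w)) : linearizingCoeff p μ adm m w = 0 := by
  rw [linearizingCoeff, dif_neg hm, if_neg hw]

theorem linearizingCoeff_apply {m : ℕ} (hm : m ≠ 1) (w : Fin m → Fin n)
    (hw : adm (Finset.univ.image w)) (j : Fin n) :
    linearizingCoeff p μ adm m w j = (wordValue μ w - μ j)⁻¹ *
      (∑ c ∈ ({c | 1 < Composition.length c}.toFinset : Finset (Composition m)),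
        p c.length fun i => linearizingCoeff p μ adm (c.blocksFun i) (w ∘ c.embedding i)) j := by
  rw [linearizingCoeff, dif_neg hm, if_pos hw]
  refine congrArg (fun v : Fin n → ℂ => (wordValue μ w - μ j)⁻¹ * v j)
    (Finset.sum_congr rfl fun c hc => congrArg (p c.length) (funext fun i => ?_))
  rw [if_pos (c.blocksFun_lt_of_one_lt_length (by simpa using hc) i)]

theorem linearizingCoeff_zero (w : Fin 0 → Fin n) : linearizingCoeff p μ adm 0 w = 0 := by
  by_cases hw : adm (Finset.univ.image w)
  · ext j
    rw [linearizingCoeff_apply p μ adm zero_ne_one w hw, Finset.sum_eq_zero, Pi.zero_apply,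
      mul_zero]
    intro c hc
    have h1 : 1 < c.length := by simpa using hc
    have := c.length_le
    omega
  · exact linearizingCoeff_of_not_adm p μ adm zero_ne_one w hw

variable {μ adm} {ω : ℕ → ℝ}

theorem norm_inv_divisor_le {θ : ℝ} (hθ : 0 < θ) {m : ℕ} (hm : 2 ≤ m) (w : Fin m → Fin n)
    (hw : adm (Finset.univ.image w)) (j : Fin n) (hne : wordValue μ w ≠ μ j) :
    ‖(wordValue μ w - μ j)⁻¹‖ ≤ θ⁻¹ * Real.exp (divisorCost μ adm θ j m w) := by
  have hpos : 0 < ‖wordValue μ w - μ j‖ := norm_pos_iff.2 (sub_ne_zero.2 hne)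
  rw [divisorCost, if_pos ⟨hm, hw⟩, norm_inv]
  calc
    ‖wordValue μ w - μ j‖⁻¹ = θ⁻¹ * (θ / ‖wordValue μ w - μ j‖) := by field_simp
    _ = θ⁻¹ * Real.exp (Real.log (θ / ‖wordValue μ w - μ j‖)) := by
      rw [Real.exp_log (by positivity)]
    _ ≤ _ := by
      gcongr
      exact le_max_right _ _

/-- The coefficients of the linearizing series, divided by the exponential of the cost of the
divisors, satisfy the recursive inequality of a power series without small divisors. -/
theorem BrjunoBound.norm_linearizingCoeff_le (h : BrjunoBound μ adm ω) (hp : 0 < p.radius) :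
    ∃ K : ℝ, 0 < K ∧ ∀ m, 1 ≤ m → ∀ w, ‖linearizingCoeff p μ adm m w‖ ≤ K ^ m := by
  obtain ⟨θ, B, hθ, hB, hcost⟩ := h.exists_treeCost_le
  obtain ⟨C, r, hC, hr, hCr⟩ := p.le_mul_pow_of_radius_pos hp
  let E : ∀ m, (Fin m → Fin n) → ℝ := fun m w => ∑ j, treeCost (divisorCost μ adm θ j) m w
  have hE0 : ∀ m w, 0 ≤ E m w := fun m w => Finset.sum_nonneg fun j _ =>
    treeCost_nonneg _ (fun m w => divisorCost_nonneg θ j m w) m w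
  have hEB : ∀ m w, E m w ≤ n * B * m := fun m w => by
    refine (Finset.sum_le_sum fun j _ => hcost j m w).trans_eq ?_
    simp; ring
  -- The largest coefficient of length `m`, with the divisors along trees divided out.
  let t : ℕ → ℝ := fun m =>
    ⨆ w : Fin m → Fin n, ‖linearizingCoeff p μ adm m w‖ * Real.exp (-E m w)
  have ht0 : ∀ m, 0 ≤ t m := fun m => Real.iSup_nonneg fun w => by positivity
  have hcoeff : ∀ m w, ‖linearizingCoeff p μ adm m w‖ ≤ t m * Real.exp (E m w) := by
    intro m w
    rw [← div_le_iff₀ (Real.exp_pos _), div_eq_mul_inv, ← Real.exp_neg]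
    exact le_ciSup (f := fun w => ‖linearizingCoeff p μ adm m w‖ * Real.exp (-E m w))
      (Set.finite_range _).bddAbove w
  have ht1 : t 1 ≤ 1 := by
    refine Real.iSup_le (fun w => ?_) zero_le_one
    rw [linearizingCoeff_one, Pi.norm_single, norm_one, one_mul]
    exact Real.exp_le_one_iff.2 (neg_nonpos.2 (hE0 _ _))
  have hrec : ∀ m, 2 ≤ m → t m ≤ ∑ c ∈ ({c | 1 < Composition.length c}.toFinset :
      Finset (Composition m)), θ⁻¹ * C * r ^ c.length * ∏ i, t (c.blocksFun i) := by
    intro m hm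
    have hrhs : 0 ≤ ∑ c ∈ ({c | 1 < Composition.length c}.toFinset : Finset (Composition m)),
        θ⁻¹ * C * r ^ c.length * ∏ i, t (c.blocksFun i) :=
      Finset.sum_nonneg fun c _ => mul_nonneg (by positivity) (Finset.prod_nonneg fun i _ => ht0 _)
    refine Real.iSup_le (fun w => ?_) hrhs
    rw [Real.exp_neg, ← div_eq_mul_inv, div_le_iff₀ (Real.exp_pos _)]
    by_cases hw : adm (Finset.univ.image w)
    swap
    · rw [linearizingCoeff_of_not_adm p μ adm (by omega) w hw, norm_zero]
      positivity
    refine (pi_norm_le_iff_of_nonneg (by positivity)).2 fun j => ?_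
    have hne : wordValue μ w ≠ μ j := by
      have := (h.pos m).trans_le
        (h.le_divisor m (by omega) m w hm Nat.lt_two_pow_self.le hw j)
      exact sub_ne_zero.1 (norm_pos_iff.1 this)
    rw [linearizingCoeff_apply p μ adm (by omega) w hw, norm_mul, Finset.sum_mul]
    calc
      _ ≤ (θ⁻¹ * Real.exp (∑ j, divisorCost μ adm θ j m w)) *
          ∑ c ∈ ({c | 1 < Composition.length c}.toFinset : Finset (Composition m)),
            C * r ^ c.length * ∏ i, (t (c.blocksFun i) *
              Real.exp (E (c.blocksFun i) (w ∘ c.embedding i))) := by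
        gcongr
        · refine (norm_inv_divisor_le hθ hm w hw j hne).trans ?_
          gcongr
          exact Finset.single_le_sum (f := fun j => divisorCost μ adm θ j m w)
            (fun j _ => divisorCost_nonneg θ j m w) (Finset.mem_univ j)
        · refine (norm_le_pi_norm _ j).trans (norm_sum_le_of_le _ fun c hc => ?_)
          refine ((p c.length).le_opNorm _).trans ?_
          gcongr with i
          · exact hCr _
          · exact hcoeff _ _
      _ ≤ _ := by
        rw [Finset.mul_sum]
        refine Finset.sum_le_sum fun c hc => ?_
        have hc1 : 1 < c.length := by simpa using hc
        have hexp : (∑ j, divisorCost μ adm θ j m w) +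
            ∑ i, E (c.blocksFun i) (w ∘ c.embedding i) ≤ E m w := by
          simp only [E]
          rw [Finset.sum_comm, ← Finset.sum_add_distrib]
          exact Finset.sum_le_sum fun j _ => sum_blocks_le_treeCost _ w c hc1
        calc
          _ = θ⁻¹ * C * r ^ c.length * (∏ i, t (c.blocksFun i)) *
              Real.exp ((∑ j, divisorCost μ adm θ j m w) +
                ∑ i, E (c.blocksFun i) (w ∘ c.embedding i)) := by
            rw [Finset.prod_mul_distrib, ← Real.exp_sum, Real.exp_add]; ring
          _ ≤ _ := by
            have := Finset.prod_nonneg fun i (_ : i ∈ Finset.univ) => ht0 (c.blocksFun i)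
            gcongr
  obtain ⟨K, hK, htK⟩ := exists_forall_le_pow_of_le_sum_composition ht0
    (C := θ⁻¹ * C) (r := r) (by positivity) hr ht1 hrec
  refine ⟨K * Real.exp (n * B), by positivity, fun m hm w => (hcoeff m w).trans ?_⟩
  rw [mul_pow, ← Real.exp_nat_mul, mul_comm (m : ℝ)]
  gcongr
  · exact htK m hm
  · exact hEB m w

/-- The coefficients of `F ∘ Φ` and `Φ ∘ diag μ` agree at every word with admissible letters. -/
theorem BrjunoBound.comp_ofWords_linearizingCoeff (h : BrjunoBound μ adm ω)
    (hp0 : p 0 = 0) (hp1 : ∀ v, p 1 (fun _ => v) = μ * v) {m : ℕ} (w : Fin m → Fin n)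
    (hw : adm (Finset.univ.image w)) :
    p.comp (.ofWords (linearizingCoeff p μ adm)) m (fun i => Pi.single (w i) 1) =
      wordValue μ w • linearizingCoeff p μ adm m w := by
  rcases Nat.eq_zero_or_pos m with rfl | hm
  · rw [FormalMultilinearSeries.comp_coeff_zero _ _ _ 0, hp0, linearizingCoeff_zero]; simp
  rw [FormalMultilinearSeries.comp_rightInv_aux1 hm, hp1]
  simp only [FormalMultilinearSeries.ofWords_apply_single]
  have happ : ∀ c : Composition m,
      (FormalMultilinearSeries.ofWords (linearizingCoeff p μ adm)).applyComposition c
        (fun i => Pi.single (w i) 1) =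
      fun i => linearizingCoeff p μ adm (c.blocksFun i) (w ∘ c.embedding i) := fun c => by
    ext1 i
    exact FormalMultilinearSeries.ofWords_apply_single _ _ (w ∘ c.embedding i)
  simp only [happ]
  by_cases hm1 : m = 1
  · subst hm1
    rw [Finset.sum_eq_zero, zero_add, linearizingCoeff_one]
    · ext j
      by_cases hj : j = w 0
      · subst hj; simp [wordValue]
      · simp [Pi.single_eq_of_ne hj]
    · intro c hc
      have h1 : 1 < c.length := by simpa using hc
      have := c.length_le
      omega
  · ext j
    have hne : wordValue μ w - μ j ≠ 0 := by
      have := (h.pos m).trans_le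
        (h.le_divisor m (by omega) m w (by omega) Nat.lt_two_pow_self.le hw j)
      exact norm_pos_iff.1 this
    have := linearizingCoeff_apply p μ adm hm1 w hw j
    rw [eq_comm, inv_mul_eq_iff_eq_mul₀ hne] at this
    rw [Pi.add_apply, this, Pi.mul_apply, Pi.smul_apply, smul_eq_mul]
    ring

/-- A germ `F` with linear part `diag μ` is linearizable on the coordinate subspaces spanned by
admissible sets of coordinates. -/
theorem BrjunoBound.exists_linearization (h : BrjunoBound μ adm ω)
    {F : (Fin n → ℂ) → (Fin n → ℂ)} (hF : AnalyticAt ℂ F 0) (hF0 : F 0 = 0)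
    (hF1 : ∀ v, fderiv ℂ F 0 v = μ * v) :
    ∃ Φ : (Fin n → ℂ) → (Fin n → ℂ), AnalyticAt ℂ Φ 0 ∧ Φ 0 = 0 ∧
      fderiv ℂ Φ 0 = ContinuousLinearMap.id ℂ (Fin n → ℂ) ∧
      ∀ S, adm S → ∀ᶠ z in 𝓝 (0 : Fin n → ℂ), (∀ j ∉ S, z j = 0) → F (Φ z) = Φ (μ * z) := by
  obtain ⟨p, hp⟩ := hF
  have hp0 : p 0 = 0 := by
    ext v : 1
    rw [hp.coeff_zero, hF0]; rfl
  have hp1 : ∀ v, p 1 (fun _ => v) = μ * v := fun v => by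
    rw [← hF1, hp.fderiv_eq]; rfl
  let q := FormalMultilinearSeries.ofWords (linearizingCoeff p μ adm)
  obtain ⟨K, hK, hcoeff⟩ := h.norm_linearizingCoeff_le p hp.radius_pos
  have hq : HasFPowerSeriesAt q.sum q 0 :=
    (q.hasFPowerSeriesOnBall
      (FormalMultilinearSeries.radius_ofWords_pos hK hcoeff)).hasFPowerSeriesAt
  have hq0 : q.sum 0 = 0 := by
    rw [← hq.coeff_zero 0]
    simp [q, FormalMultilinearSeries.ofWords_apply, linearizingCoeff_zero]
  refine ⟨q.sum, hq.analyticAt, hq0, ?_, fun S hS => ?_⟩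
  · rw [hq.fderiv_eq]
    ext1 v
    change q 1 (fun _ => v) = v
    rw [ContinuousMultilinearMap.apply_const_eq_sum_words]
    simp only [q, FormalMultilinearSeries.ofWords_apply_single, linearizingCoeff_one, wordValue]
    rw [← (Equiv.funUnique (Fin 1) (Fin n)).symm.sum_comp]
    simpa using (pi_eq_sum_univ' v).symm
  · have h1 : HasFPowerSeriesAt (F ∘ q.sum) (p.comp q) 0 :=
      HasFPowerSeriesAt.comp (by rw [hq0]; exact hp) hq
    have h2 : HasFPowerSeriesAt (q.sum ∘ ContinuousLinearMap.mul ℂ (Fin n → ℂ) μ)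
        (q.compContinuousLinearMap (ContinuousLinearMap.mul ℂ (Fin n → ℂ) μ)) 0 :=
      HasFPowerSeriesAt.compContinuousLinearMap (by rw [map_zero]; exact hq)
    filter_upwards [h1.eventually_hasSum, h2.eventually_hasSum] with z hz1 hz2 hzS
    rw [zero_add] at hz1 hz2
    refine hz1.unique (hz2.congr_fun fun m => ?_)
    rw [ContinuousMultilinearMap.apply_const_eq_sum_words,
      ContinuousMultilinearMap.apply_const_eq_sum_words]
    refine Finset.sum_congr rfl fun w _ => ?_
    by_cases hw : ∃ i, w i ∉ S
    · obtain ⟨i, hi⟩ := hw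
      have : wordValue z w = 0 := Finset.prod_eq_zero (Finset.mem_univ i) (hzS _ hi)
      rw [this, zero_smul, zero_smul]
    · push Not at hw
      rw [h.comp_ofWords_linearizingCoeff p hp0 hp1 w
        (h.mono _ S (fun x hx => by
          obtain ⟨i, -, rfl⟩ := Finset.mem_image.1 hx; exact hw i) hS)]
      congr 1
      rw [FormalMultilinearSeries.compContinuousLinearMap_apply]
      rw [wordValue, ← FormalMultilinearSeries.ofWords_apply_smul_single]
      congr 1
      ext i j
      by_cases hj : j = w i
      · subst hj; simp
      · simp [Pi.single_eq_of_ne hj]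

end Linearization

/-! ### Uniqueness of the linearization -/

/-- A sum of eigenvectors with eigenvalues different from `κ` that lies in the eigenspace of `κ`
vanishes. -/
theorem LinearMap.sum_eq_zero_of_eigenvectors {𝕜 V ι : Type*} [Field 𝕜] [AddCommGroup V]
    [Module 𝕜 V] (L : V →ₗ[𝕜] V) (κ : 𝕜) (s : Finset ι) :
    ∀ (f : ι → V) (lam : ι → 𝕜), (∀ i ∈ s, L (f i) = lam i • f i) → (∀ i ∈ s, lam i ≠ κ) →
      L (∑ i ∈ s, f i) = κ • ∑ i ∈ s, f i → ∑ i ∈ s, f i = 0 := by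
  classical
  induction s using Finset.induction_on with
  | empty => intros; simp
  | insert i₀ s hi ih =>
    intro f lam hf hne hL
    have h1 : ∑ i ∈ s, (lam i - lam i₀) • f i = (κ - lam i₀) • ∑ i ∈ insert i₀ s, f i := by
      rw [sub_smul, ← hL, map_sum, Finset.smul_sum, ← Finset.sum_sub_distrib,
        Finset.sum_insert hi, hf i₀ (Finset.mem_insert_self _ _), sub_self, zero_add]
      exact Finset.sum_congr rfl fun i h => by
        rw [hf i (Finset.mem_insert_of_mem h), sub_smul]
    have h2 := ih (fun i => (lam i - lam i₀) • f i) lam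
      (fun i h => by rw [map_smul, hf i (Finset.mem_insert_of_mem h), smul_comm])
      (fun i h => hne i (Finset.mem_insert_of_mem h))
      (by rw [h1, map_smul, hL, smul_comm])
    rw [h1] at h2
    exact (smul_eq_zero.1 h2).resolve_left
      (sub_ne_zero.2 (hne i₀ (Finset.mem_insert_self _ _)).symm)

section Uniqueness

variable {n : ℕ} {μ : Fin n → ℂ}

theorem wordValue_mul {m : ℕ} (μ z : Fin n → ℂ) (w : Fin m → Fin n) :
    wordValue (μ * z) w = wordValue μ w * wordValue z w := by
  simp [wordValue, Finset.prod_mul_distrib]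

/-- A homogeneous polynomial map without resonant monomials which commutes with `diag μ` is zero. -/
theorem ContinuousMultilinearMap.apply_const_eq_zero_of_commute {m : ℕ}
    (T : ContinuousMultilinearMap ℂ (fun _ : Fin m => Fin n → ℂ) (Fin n → ℂ))
    (hT : ∀ w : Fin m → Fin n, T (fun i => Pi.single (w i) 1) ≠ 0 → ∀ j, wordValue μ w ≠ μ j)
    (hcomm : ∀ z, T (fun _ => μ * z) = μ * T (fun _ => z)) (z : Fin n → ℂ) :
    T (fun _ => z) = 0 := by
  classical
  ext j
  let s : Finset (Fin m → Fin n) :=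
    Finset.univ.filter fun w => T (fun i => Pi.single (w i) 1) ≠ 0
  let f : (Fin m → Fin n) → (Fin n → ℂ) → ℂ :=
    fun w z => wordValue z w * T (fun i => Pi.single (w i) 1) j
  have hsum : ∀ z, (∑ w ∈ s, f w) z = T (fun _ => z) j := by
    intro z
    rw [T.apply_const_eq_sum_words, Finset.sum_apply, Finset.sum_apply]
    refine Finset.sum_filter_of_ne fun w _ hw h0 => hw ?_
    simp [f, h0]
  have h0 := LinearMap.sum_eq_zero_of_eigenvectors
    (LinearMap.funLeft ℂ ℂ fun z : Fin n → ℂ => μ * z) (μ j) s f (wordValue μ) ?_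
    (fun w hw => hT w (Finset.mem_filter.1 hw).2 j) ?_
  · rw [← hsum, h0]; rfl
  · intro w _
    ext z
    simp only [LinearMap.funLeft_apply, f, wordValue_mul, Pi.smul_apply, smul_eq_mul]
    ring
  · ext z
    rw [LinearMap.funLeft_apply, hsum, hcomm, Pi.smul_apply, hsum]
    rfl

/-- Two linearizations on a coordinate subspace without resonances agree there: the lowest order
term of their difference would commute with `diag μ`. -/
theorem eventually_eq_of_linearizations {F G₁ G₂ : (Fin n → ℂ) → (Fin n → ℂ)}
    (hF : AnalyticAt ℂ F 0) (hF1 : ∀ v, fderiv ℂ F 0 v = μ * v)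
    (hG₁ : AnalyticAt ℂ G₁ 0) (hG₁0 : G₁ 0 = 0)
    (hG₂ : AnalyticAt ℂ G₂ 0) (hG₂0 : G₂ 0 = 0)
    (hG : fderiv ℂ G₁ 0 = fderiv ℂ G₂ 0) {S : Finset (Fin n)}
    (hS : ∀ m, 2 ≤ m → ∀ w : Fin m → Fin n, (∀ i, w i ∈ S) → ∀ j, wordValue μ w ≠ μ j)
    (h₁ : ∀ᶠ z in 𝓝 (0 : Fin n → ℂ), (∀ j ∉ S, z j = 0) → F (G₁ z) = G₁ (μ * z))
    (h₂ : ∀ᶠ z in 𝓝 (0 : Fin n → ℂ), (∀ j ∉ S, z j = 0) → F (G₂ z) = G₂ (μ * z)) :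
    ∀ᶠ z in 𝓝 (0 : Fin n → ℂ), (∀ j ∉ S, z j = 0) → G₁ z = G₂ z := by
  classical
  -- `π` is the projection to the coordinates in `S`.
  let χ : Fin n → ℂ := fun j => if j ∈ S then 1 else 0
  let π : (Fin n → ℂ) →L[ℂ] (Fin n → ℂ) := ContinuousLinearMap.mul ℂ (Fin n → ℂ) χ
  have hπ : ∀ z, (∀ j ∉ S, z j = 0) → π z = z := by
    intro z hz
    ext j
    by_cases hj : j ∈ S
    · simp [π, χ, hj]
    · simp [π, χ, hj, hz j hj]
  have hπS : ∀ z, ∀ j ∉ S, π z j = 0 := fun z j hj => by simp [π, χ, hj]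
  have hπμ : ∀ z, μ * π z = π (μ * z) := fun z => mul_left_comm _ _ _
  have hπ0 : Tendsto π (𝓝 0) (𝓝 0) := by
    simpa using π.continuous.tendsto 0
  have hμ0 : Tendsto (fun z => μ * z) (𝓝 0) (𝓝 (0 : Fin n → ℂ)) := by
    have h := (ContinuousLinearMap.mul ℂ (Fin n → ℂ) μ).continuous.tendsto 0
    rw [map_zero] at h
    exact h
  obtain ⟨p, hp⟩ := hF
  have hp1 : ∀ v, p 1 (fun _ => v) = μ * v := fun v => by
    rw [← hF1, hp.fderiv_eq]; rfl
  obtain ⟨d, hd⟩ := hG₁.sub hG₂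
  let Δ : (Fin n → ℂ) → (Fin n → ℂ) := (G₁ - G₂) ∘ π
  let q := d.compContinuousLinearMap π
  have hq : HasFPowerSeriesAt Δ q 0 :=
    HasFPowerSeriesAt.compContinuousLinearMap (by rw [map_zero]; exact hd)
  have hqS : ∀ m (w : Fin m → Fin n), q m (fun i => Pi.single (w i) 1) ≠ 0 → ∀ i, w i ∈ S := by
    intro m w hw i
    by_contra hi
    refine hw ((d m).map_coord_zero i ?_)
    ext j
    by_cases hj : j = w i
    · subst hj; simp [π, χ, hi]
    · simp [π, Pi.single_eq_of_ne hj]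
  -- The defect of linearity of `F` between the two linearizations is of higher order.
  have hdefect : (fun z => Δ (μ * z) - μ * Δ z) =O[𝓝 0] fun z => ‖z‖ * ‖Δ z‖ := by
    have hpair : Tendsto (fun z => (G₁ (π z), G₂ (π z))) (𝓝 0) (𝓝 ((0, 0) : _ × _)) := by
      have t₁ := hG₁.continuousAt.tendsto.comp hπ0
      have t₂ := hG₂.continuousAt.tendsto.comp hπ0
      rw [hG₁0] at t₁
      rw [hG₂0] at t₂
      exact t₁.prodMk_nhds t₂
    have hO := hp.isBigO_image_sub_norm_mul_norm_sub.comp_tendsto hpair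
    have hlin : (fun z => (G₁ (π z), G₂ (π z))) =O[𝓝 0] fun z => z := by
      have o₁ := hG₁.differentiableAt.isBigO_sub.comp_tendsto hπ0
      have o₂ := hG₂.differentiableAt.isBigO_sub.comp_tendsto hπ0
      simp only [hG₁0, hG₂0, Function.comp_def, sub_zero] at o₁ o₂
      exact (o₁.trans (π.isBigO_id _)).prod_left (o₂.trans (π.isBigO_id _))
    refine (hO.trans ?_).congr' ?_ EventuallyEq.rfl
    · simp only [Function.comp_def, Prod.mk_zero_zero, sub_zero]
      exact hlin.norm_norm.mul (Asymptotics.isBigO_refl _ _)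
    · filter_upwards [hπ0.eventually h₁, hπ0.eventually h₂] with z hz₁ hz₂
      simp only [Function.comp_apply, hp1, hz₁ (hπS z), hz₂ (hπS z), Δ, Pi.sub_apply, hπμ]
  have hzero : ∀ m z, q m (fun _ => z) = 0 := by
    intro m
    induction m using Nat.strong_induction_on with
    | _ m ih =>
      rcases Nat.lt_or_ge m 2 with hm | hm
      · interval_cases m
        · intro z
          rw [hq.coeff_zero]
          simp [Δ, hG₁0, hG₂0]
        · intro z
          have h1 : d 1 (fun _ => π z) = 0 := by
            have h2 : fderiv ℂ (G₁ - G₂) 0 (π z) = d 1 (fun _ => π z) := by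
              rw [hd.fderiv_eq]; rfl
            rw [← h2, fderiv_sub hG₁.differentiableAt hG₂.differentiableAt, hG, sub_self]
            rfl
          exact h1
      · have hT : (fun z => Δ z - q m (fun _ => z)) =O[𝓝 0] fun z => ‖z‖ ^ (m + 1) := by
          refine (hq.isBigO_sub_partialSum_pow (m + 1)).congr_left fun z => ?_
          rw [zero_add, FormalMultilinearSeries.partialSum, Finset.sum_range_succ,
            Finset.sum_eq_zero fun k hk => ih k (Finset.mem_range.1 hk) z, zero_add]
        have hΔ : Δ =O[𝓝 0] fun z => ‖z‖ ^ m := by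
          refine (hq.isBigO_sub_partialSum_pow m).congr_left fun z => ?_
          rw [zero_add, FormalMultilinearSeries.partialSum,
            Finset.sum_eq_zero fun k hk => ih k (Finset.mem_range.1 hk) z, sub_zero]
        have hμO : (fun z : Fin n → ℂ => ‖μ * z‖ ^ (m + 1)) =O[𝓝 0] fun z => ‖z‖ ^ (m + 1) := by
          have := (ContinuousLinearMap.mul ℂ (Fin n → ℂ) μ).isBigO_id (𝓝 0)
          exact this.norm_norm.pow _
        have hT' : (fun z => Δ (μ * z) - q m (fun _ => μ * z)) =O[𝓝 0] fun z => ‖z‖ ^ (m + 1) :=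
          (hT.comp_tendsto hμ0).trans hμO
        have hμT : (fun z => μ * (Δ z - q m (fun _ => z))) =O[𝓝 0] fun z => ‖z‖ ^ (m + 1) :=
          ((ContinuousLinearMap.mul ℂ (Fin n → ℂ) μ).isBigO_comp _ _).trans hT
        have hΔ' : (fun z => Δ (μ * z) - μ * Δ z) =O[𝓝 0] fun z => ‖z‖ ^ (m + 1) := by
          refine hdefect.trans ?_
          simp only [pow_succ']
          exact (Asymptotics.isBigO_refl _ _).mul hΔ.norm_left
        -- The multilinear map whose diagonal is the commutator of the term of order `m` with
        -- `diag μ`.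
        let μL := ContinuousLinearMap.mul ℂ (Fin n → ℂ) μ
        let D := (q m).compContinuousLinearMap (fun _ => μL) -
          μL.compContinuousMultilinearMap (q m)
        have hD : ∀ z, D (fun _ => z) = q m (fun _ => μ * z) - μ * q m (fun _ => z) :=
          fun z => rfl
        have hD0 : ∀ z, D (fun _ => z) = 0 := by
          refine Asymptotics.IsBigO.continuousMultilinearMap_apply_eq_zero ?_
          refine ((hΔ'.sub hT').add hμT).congr_left fun z => ?_
          rw [hD, mul_sub]
          abel
        exact (q m).apply_const_eq_zero_of_commute (fun w hw => hS m hm w (hqS m w hw))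
          fun z => sub_eq_zero.1 ((hD z).symm.trans (hD0 z))
  filter_upwards [hq.eventually_hasSum] with z hz hzS
  have h0 : Δ z = 0 := by
    rw [zero_add] at hz
    refine hz.unique ?_
    simp only [hzero]
    exact hasSum_zero
  have : G₁ (π z) - G₂ (π z) = 0 := h0
  rwa [hπ z hzS, sub_eq_zero] at this

end Uniqueness

/-! ### Antiholomorphic germs -/

section Antiholomorphic

variable {n : ℕ}

/-- The complex conjugate `v ↦ conj (T (conj v))` of a multilinear map. -/
def ContinuousMultilinearMap.conj {m : ℕ}
    (T : ContinuousMultilinearMap ℂ (fun _ : Fin m => Fin n → ℂ) (Fin n → ℂ)) :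
    ContinuousMultilinearMap ℂ (fun _ : Fin m => Fin n → ℂ) (Fin n → ℂ) :=
  MultilinearMap.mkContinuous
    { toFun := fun v => star (T fun i => star (v i))
      map_update_add' := fun v i x y => by
        have h : ∀ x, (fun k => star (Function.update v i x k)) =
            Function.update (fun k => star (v k)) i (star x) :=
          Function.comp_update star v i
        simp only [h, star_add, ContinuousMultilinearMap.map_update_add]
      map_update_smul' := fun v i c x => by
        have h : ∀ x, (fun k => star (Function.update v i x k)) =
            Function.update (fun k => star (v k)) i (star x) :=
          Function.comp_update star v i
        simp only [h, star_smul, ContinuousMultilinearMap.map_update_smul, star_star] }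
    ‖T‖ fun v => by
      simpa using T.le_opNorm fun i => star (v i)

/-- If `G` is holomorphic, so is `z ↦ conj (G (conj z))`. -/
theorem AnalyticAt.conj_conj {G : (Fin n → ℂ) → (Fin n → ℂ)} (hG : AnalyticAt ℂ G 0) :
    AnalyticAt ℂ (fun z => star (G (star z))) 0 := by
  obtain ⟨p, r, hp⟩ := hG
  refine ⟨fun m => (p m).conj, r, ?_, hp.r_pos, fun {y} hy => ?_⟩
  · refine hp.r_le.trans (FormalMultilinearSeries.radius_le_of_le fun m => ?_)
    exact MultilinearMap.mkContinuous_norm_le _ (norm_nonneg _) _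
  · have hy' : star y ∈ Metric.eball (0 : Fin n → ℂ) r := by
      simpa [Metric.mem_eball, edist_zero_right, enorm_eq_nnnorm] using hy
    have h := (hp.hasSum hy').star
    simp only [zero_add] at h ⊢
    exact h

/-- The antilinear part `v ↦ B * conj v` of an antiholomorphic germ. -/
def antiDeriv (ρ : (Fin n → ℂ) → (Fin n → ℂ)) (v : Fin n → ℂ) : Fin n → ℂ :=
  (antiLinearPart ρ).mulVec (star v)

theorem antiDeriv_eq_fderiv (ρ : (Fin n → ℂ) → (Fin n → ℂ)) (v : Fin n → ℂ) :
    antiDeriv ρ v = fderiv ℂ (fun z => ρ (star z)) 0 (star v) := by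
  rw [antiDeriv, antiLinearPart, linearPart, LinearMap.toMatrix'_mulVec]
  rfl

theorem antiDeriv_star (ρ : (Fin n → ℂ) → (Fin n → ℂ)) (v : Fin n → ℂ) :
    antiDeriv ρ (star v) = fderiv ℂ (fun z => ρ (star z)) 0 v := by
  rw [antiDeriv_eq_fderiv, star_star]

theorem antiDeriv_zero (ρ : (Fin n → ℂ) → (Fin n → ℂ)) : antiDeriv ρ 0 = 0 := by
  simp [antiDeriv]

theorem analyticAt_antiDeriv_star (ρ : (Fin n → ℂ) → (Fin n → ℂ)) :
    AnalyticAt ℂ (fun z => antiDeriv ρ (star z)) 0 := by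
  simp only [antiDeriv_star]
  exact ContinuousLinearMap.analyticAt _ _

/-- The map `antiDeriv ρ` is its own antilinear part. -/
theorem antiDeriv_antiDeriv (ρ : (Fin n → ℂ) → (Fin n → ℂ)) (v : Fin n → ℂ) :
    antiDeriv (antiDeriv ρ) v = antiDeriv ρ v := by
  rw [antiDeriv_eq_fderiv]
  simp only [antiDeriv_star]
  rw [ContinuousLinearMap.fderiv, antiDeriv_eq_fderiv]

theorem continuousAt_of_antiholomorphic {ρ : (Fin n → ℂ) → (Fin n → ℂ)}
    (h : AnalyticAt ℂ (fun z => ρ (star z)) 0) : ContinuousAt ρ 0 := by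
  have h1 : ContinuousAt (fun z => ρ (star z)) (star 0) := by rw [star_zero]; exact h.continuousAt
  simpa [Function.comp_def] using h1.comp (continuous_star.continuousAt (x := (0 : Fin n → ℂ)))

/-- A holomorphic germ between two antiholomorphic ones gives a holomorphic germ. -/
theorem AnalyticAt.antiholomorphic_comp_comp {ρ₁ ρ₂ G : (Fin n → ℂ) → (Fin n → ℂ)}
    (h₁ : AnalyticAt ℂ (fun z => ρ₁ (star z)) 0) (h₂ : AnalyticAt ℂ (fun z => ρ₂ (star z)) 0)
    (hG : AnalyticAt ℂ G 0) (hρ₂ : ρ₂ 0 = 0) (hG0 : G 0 = 0) :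
    AnalyticAt ℂ (fun z => ρ₁ (G (ρ₂ z))) 0 ∧ ∀ v, fderiv ℂ (fun z => ρ₁ (G (ρ₂ z))) 0 v =
      antiDeriv ρ₁ (fderiv ℂ G 0 (antiDeriv ρ₂ v)) := by
  let H : (Fin n → ℂ) → (Fin n → ℂ) := fun z => G (ρ₂ (star z))
  have hH : AnalyticAt ℂ H 0 := AnalyticAt.comp_of_eq hG h₂ (by simp [hρ₂])
  have hH0 : star (H (star 0)) = 0 := by simp [H, hρ₂, hG0]
  have heq : (fun z => ρ₁ (G (ρ₂ z))) = (fun z => ρ₁ (star z)) ∘ fun z => star (H (star z)) := by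
    ext1 z; simp [H]
  have hHd : HasFDerivAt H ((fderiv ℂ G 0).comp (fderiv ℂ (fun z => ρ₂ (star z)) 0)) 0 := by
    refine HasFDerivAt.comp (g := G) 0 ?_ h₂.differentiableAt.hasFDerivAt
    simpa [hρ₂] using hG.differentiableAt.hasFDerivAt
  have hHs := hHd.star_star
  rw [star_zero] at hHs
  rw [heq]
  refine ⟨AnalyticAt.comp_of_eq h₁ hH.conj_conj hH0, fun v => ?_⟩
  have h₁' : HasFDerivAt (fun z => ρ₁ (star z)) (fderiv ℂ (fun z => ρ₁ (star z)) 0)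
      ((star ∘ H ∘ star) 0) := by
    rw [Function.comp_apply, Function.comp_apply, hH0]
    exact h₁.differentiableAt.hasFDerivAt
  have hc := (h₁'.comp 0 hHs).fderiv
  have hcomp : (fun z => ρ₁ (star z)) ∘ (fun z => star (H (star z))) =
      (fun z => ρ₁ (star z)) ∘ (star ∘ H ∘ star) := rfl
  rw [hcomp, hc, antiDeriv_eq_fderiv, antiDeriv_eq_fderiv]
  rfl

end Antiholomorphic

/-! ### The resonant locus as a union of coordinate subspaces -/

section ResonantLocus

variable {n p : ℕ} {l : ℕ} {R : Fin p → Fin n →₀ ℕ}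

/-- The coordinate subspace of the coordinates in `S` lies in the resonant locus. -/
def IsLocusSupport (l : ℕ) (R : Fin p → Fin n →₀ ℕ) (S : Finset (Fin n)) : Prop :=
  (∀ j ∈ S, ¬ (j : ℕ) < l) ∧ ∀ i, ∃ j ∈ (R i).support, j ∉ S

theorem IsLocusSupport.mono {S S' : Finset (Fin n)} (h : S ⊆ S') (hS : IsLocusSupport l R S') :
    IsLocusSupport l R S :=
  ⟨fun j hj => hS.1 j (h hj), fun i => (hS.2 i).imp fun _ hj => ⟨hj.1, fun h' => hj.2 (h h')⟩⟩

theorem monomialValue_eq_zero_iff {z : Fin n → ℂ} {Q : Fin n →₀ ℕ} :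
    monomialValue z Q = 0 ↔ ∃ j ∈ Q.support, z j = 0 := by
  simp only [monomialValue, Finset.prod_eq_zero_iff, Finset.mem_univ, true_and, pow_eq_zero_iff',
    Finsupp.mem_support_iff]
  exact exists_congr fun j => and_comm

/-- Membership in the resonant locus depends only on the set of non-zero coordinates. -/
theorem mem_resonantLocus_iff {z : Fin n → ℂ} :
    z ∈ resonantLocus l R ↔ IsLocusSupport l R (Finset.univ.filter fun j => z j ≠ 0) := by
  simp only [resonantLocus, Set.mem_ofPred_eq, IsLocusSupport, monomialValue_eq_zero_iff,
    Finset.mem_filter, Finset.mem_univ, true_and, not_not]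
  refine and_congr_left fun _ => forall_congr' fun j => ?_
  tauto

theorem mem_resonantLocus_of_support {S : Finset (Fin n)} (hS : IsLocusSupport l R S)
    {z : Fin n → ℂ} (hz : ∀ j ∉ S, z j = 0) : z ∈ resonantLocus l R :=
  mem_resonantLocus_iff.2 (hS.mono fun j hj => by
    by_contra h
    exact (Finset.mem_filter.1 hj).2 (hz j h))

theorem monomial_notMem_resonantIdeal {Q : Fin n →₀ ℕ} (hQ : IsLocusSupport l R Q.support) :
    MvPolynomial.monomial Q (1 : ℂ) ∉ resonantIdeal l R := by
  intro hmem
  -- Evaluate at a point of the locus all of whose coordinates on the support of `Q` are `1`.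
  let z : Fin n → ℂ := fun j => if j ∈ Q.support then 1 else 0
  have hz : z ∈ resonantLocus l R :=
    mem_resonantLocus_of_support hQ fun j hj => if_neg hj
  have hle : resonantIdeal l R ≤ RingHom.ker (MvPolynomial.eval z) := by
    refine Ideal.span_le.2 ?_
    rintro f (⟨j, hj, rfl⟩ | ⟨i, rfl⟩)
    · simpa [RingHom.mem_ker] using hz.1 j hj
    · have := hz.2 i
      simpa [RingHom.mem_ker, MvPolynomial.eval_monomial, monomialValue,
        Finsupp.prod_fintype] using this
  have h0 : MvPolynomial.eval z (MvPolynomial.monomial Q (1 : ℂ)) = 0 := hle hmem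
  rw [MvPolynomial.eval_monomial, one_mul, Finsupp.prod_fintype _ _ (by simp)] at h0
  obtain ⟨j, hj, hzj⟩ := monomialValue_eq_zero_iff.1 h0
  simp only [z, if_pos hj] at hzj
  exact one_ne_zero hzj

/-- A property that holds near the origin on each of the finitely many coordinate subspaces in the
resonant locus holds near the origin on the resonant locus. -/
theorem eventually_resonantLocus {P : (Fin n → ℂ) → Prop}
    (h : ∀ S, IsLocusSupport l R S → ∀ᶠ z in 𝓝 (0 : Fin n → ℂ), (∀ j ∉ S, z j = 0) → P z) :
    ∀ᶠ z in 𝓝 (0 : Fin n → ℂ), z ∈ resonantLocus l R → P z := by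
  have h' := eventually_all.2 fun S : {S // IsLocusSupport l R S} => h S.1 S.2
  filter_upwards [h'] with z hz hzV
  refine hz ⟨_, mem_resonantLocus_iff.1 hzV⟩ fun j hj => ?_
  simpa using hj

/-- The exponent of the commutative monomial of a word. -/
def wordExponent {m : ℕ} (w : Fin m → Fin n) : Fin n →₀ ℕ :=
  ∑ i, Finsupp.single (w i) 1

theorem degree_wordExponent {m : ℕ} (w : Fin m → Fin n) : (wordExponent w).degree = m := by
  simp [wordExponent, map_sum]

theorem monomialValue_add (μ : Fin n → ℂ) (P Q : Fin n →₀ ℕ) :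
    monomialValue μ (P + Q) = monomialValue μ P * monomialValue μ Q := by
  simp [monomialValue, pow_add, Finset.prod_mul_distrib]

theorem monomialValue_zero (μ : Fin n → ℂ) : monomialValue μ 0 = 1 := by
  simp [monomialValue]

theorem monomialValue_single (μ : Fin n → ℂ) (j : Fin n) (k : ℕ) :
    monomialValue μ (Finsupp.single j k) = μ j ^ k := by
  rw [monomialValue, Finset.prod_eq_single j]
  · simp
  · intro i _ hi
    simp [Finsupp.single_eq_of_ne hi]
  · simp

theorem monomialValue_sum {ι : Type*} (μ : Fin n → ℂ) (s : Finset ι) (Q : ι → Fin n →₀ ℕ) :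
    monomialValue μ (∑ i ∈ s, Q i) = ∏ i ∈ s, monomialValue μ (Q i) := by
  classical
  induction s using Finset.induction_on with
  | empty => simp [monomialValue_zero]
  | insert i s hi ih => rw [Finset.sum_insert hi, Finset.prod_insert hi, monomialValue_add, ih]

theorem monomialValue_wordExponent (μ : Fin n → ℂ) {m : ℕ} (w : Fin m → Fin n) :
    monomialValue μ (wordExponent w) = wordValue μ w := by
  simp [wordExponent, monomialValue_sum, monomialValue_single, wordValue]

theorem support_wordExponent_subset {m : ℕ} (w : Fin m → Fin n) :
    (wordExponent w).support ⊆ Finset.univ.image w := by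
  intro j hj
  obtain ⟨i, -, hi⟩ := Finset.exists_ne_zero_of_sum_ne_zero (by
    simpa [wordExponent, Finsupp.finsetSum_apply] using hj :
      ∑ i, (Finsupp.single (w i) 1 : Fin n →₀ ℕ) j ≠ 0)
  have : w i = j := by
    by_contra h
    exact hi (Finsupp.single_eq_of_ne (Ne.symm h))
  exact this ▸ Finset.mem_image_of_mem _ (Finset.mem_univ _)

variable {μ : Fin n → ℂ}

theorem wordValue_ne_of_isLocusSupport
    (hres : ∀ (Q : Fin n →₀ ℕ) (j : Fin n), 2 ≤ Q.degree → monomialValue μ Q = μ j →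
      MvPolynomial.monomial Q (1 : ℂ) ∈ resonantIdeal l R) {m : ℕ} (hm : 2 ≤ m)
    (w : Fin m → Fin n) (hw : IsLocusSupport l R (Finset.univ.image w)) (j : Fin n) :
    wordValue μ w ≠ μ j := fun h =>
  monomial_notMem_resonantIdeal (hw.mono (support_wordExponent_subset w))
    (hres _ j (by rwa [degree_wordExponent]) (by rwa [monomialValue_wordExponent]))

/-- As soon as there is a divisor at level `k`, the infimum defining `smallDivisor` is over a
non-empty finite set of positive numbers. -/
theorem smallDivisor_pos_le {I : Ideal (MvPolynomial (Fin n) ℂ)} {k : ℕ} {Q : Fin n →₀ ℕ}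
    (hQ2 : 2 ≤ Q.degree) (hQk : Q.degree ≤ 2 ^ k) (hQI : MvPolynomial.monomial Q (1 : ℂ) ∉ I)
    {j : Fin n} (hne : monomialValue μ Q ≠ μ j) :
    0 < smallDivisor μ I k ∧ smallDivisor μ I k ≤ ‖monomialValue μ Q - μ j‖ := by
  set D : Set ℝ := {δ : ℝ | ∃ (Q : Fin n →₀ ℕ) (j : Fin n), 2 ≤ Q.degree ∧ Q.degree ≤ 2 ^ k ∧
    MvPolynomial.monomial Q (1 : ℂ) ∉ I ∧ δ = ‖monomialValue μ Q - μ j‖ ∧ δ ≠ 0}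
  have hmem : ‖monomialValue μ Q - μ j‖ ∈ D :=
    ⟨Q, j, hQ2, hQk, hQI, rfl, norm_ne_zero_iff.2 (sub_ne_zero.2 hne)⟩
  have hfin : D.Finite := by
    refine (((Finsupp.finite_of_degree_le (σ := Fin n) (2 ^ k)).prod Set.finite_univ).image
      fun x : (Fin n →₀ ℕ) × Fin n => ‖monomialValue μ x.1 - μ x.2‖).subset ?_
    rintro δ ⟨Q, j, -, hk, -, rfl, -⟩
    exact ⟨(Q, j), ⟨hk, Set.mem_univ _⟩, rfl⟩
  refine ⟨?_, csInf_le hfin.bddBelow hmem⟩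
  obtain ⟨Q', j', -, -, -, h1, h2⟩ := Set.Nonempty.csInf_mem ⟨_, hmem⟩ hfin
  exact lt_of_le_of_ne ((norm_nonneg _).trans_eq h1.symm) (Ne.symm h2)

/-- The diophantine condition bounds the divisors of the words supported in the resonant locus. The
bounds are truncated at `1`, symmetrically in the logarithm, so that the junk value of an infimum
over the empty set does no harm. -/
theorem IsDiophantineOn.brjunoBound (hμ0 : ∀ j, μ j ≠ 0)
    (hres : ∀ (Q : Fin n →₀ ℕ) (j : Fin n), 2 ≤ Q.degree → monomialValue μ Q = μ j →
      MvPolynomial.monomial Q (1 : ℂ) ∈ resonantIdeal l R)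
    (hdio : IsDiophantineOn μ (resonantIdeal l R)) :
    BrjunoBound μ (IsLocusSupport l R)
      fun k => Real.exp (-|Real.log (smallDivisor μ (resonantIdeal l R) k)|) where
  ne_zero := hμ0
  mono := fun _ _ h hS => hS.mono h
  pos := fun k => Real.exp_pos _
  le_one := fun k => Real.exp_le_one_iff.2 (neg_nonpos.2 (abs_nonneg _))
  summable := by
    refine (Summable.abs hdio).congr fun k => ?_
    rw [Real.log_exp, neg_neg, abs_div, abs_neg,
      abs_of_pos (a := (2 : ℝ) ^ (k + 1)) (by positivity)]
  le_divisor := by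
    intro k _ m w hm hmk hw j
    have hne := wordValue_ne_of_isLocusSupport hres hm w hw j
    rw [← monomialValue_wordExponent] at hne ⊢
    obtain ⟨hpos, hle⟩ := smallDivisor_pos_le (k := k) (by rwa [degree_wordExponent])
      (by rwa [degree_wordExponent])
      (monomial_notMem_resonantIdeal (hw.mono (support_wordExponent_subset w))) hne
    refine le_trans ?_ hle
    calc
      _ ≤ Real.exp (Real.log (smallDivisor μ (resonantIdeal l R) k)) :=
        Real.exp_le_exp.2 (neg_abs_le _)
      _ = _ := Real.exp_log hpos

/-- A coordinate subspace in the resonant locus carries no generator of the resonance monoid, hence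
no non-trivial element of it. -/
theorem eq_zero_of_mem_closure_of_support {S : Finset (Fin n)} (hS : IsLocusSupport l R S)
    {P : Fin n →₀ ℕ} (hP : P ∈ AddSubmonoid.closure
      ({P | ∃ j : Fin n, (j : ℕ) < l ∧ P = Finsupp.single j 1} ∪ Set.range R))
    (hPS : P.support ⊆ S) : P = 0 := by
  classical
  induction hP using AddSubmonoid.closure_induction with
  | mem P hP =>
    exfalso
    rcases hP with ⟨j, hj, rfl⟩ | ⟨i, rfl⟩
    · exact hS.1 j (hPS (by simp)) hj
    · obtain ⟨j, hj, hjS⟩ := hS.2 i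
      exact hjS (hPS hj)
  | zero => rfl
  | add P Q _ _ ihP ihQ =>
    have hP : P.support ⊆ S := fun j hj => hPS (by
      simp only [Finsupp.mem_support_iff, Finsupp.add_apply] at hj ⊢; omega)
    have hQ : Q.support ⊆ S := fun j hj => hPS (by
      simp only [Finsupp.mem_support_iff, Finsupp.add_apply] at hj ⊢; omega)
    rw [ihP hP, ihQ hQ, add_zero]

/-- The resonant locus is invariant under `z ↦ B * conj z` when `B` intertwines `diag μ` with its
conjugate inverse: every resonant monomial pulls back to a combination of resonant monomials. -/
theorem mulVec_star_mem_resonantLocus {B : Matrix (Fin n) (Fin n) ℂ}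
    (hB : ∀ j k, B j k ≠ 0 → μ j * star (μ k) = 1)
    (hl : ∀ j : Fin n, (j : ℕ) < l → μ j = 1)
    (hR0 : ∀ i, R i ≠ 0) (hR : ∀ i, monomialValue μ (R i) = 1)
    (hgen : ∀ Q : Fin n →₀ ℕ, monomialValue μ Q = 1 →
      Q ∈ AddSubmonoid.closure
        ({P | ∃ j : Fin n, (j : ℕ) < l ∧ P = Finsupp.single j 1} ∪ Set.range R))
    {z : Fin n → ℂ} (hz : z ∈ resonantLocus l R) : B.mulVec (star z) ∈ resonantLocus l R := by
  have hS := mem_resonantLocus_iff.1 hz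
  -- A resonant monomial that is non-zero at the image has a non-zero counterpart at `z`.
  have key : ∀ Q : Fin n →₀ ℕ, Q ≠ 0 → monomialValue μ Q = 1 →
      monomialValue (B.mulVec (star z)) Q = 0 := by
    intro Q hQ0 hQ
    by_contra hne
    have hex : ∀ j, ∃ k, j ∈ Q.support → z k ≠ 0 ∧ μ j * star (μ k) = 1 := by
      intro j
      by_cases hj : j ∈ Q.support
      · have hj0 : B.mulVec (star z) j ≠ 0 := fun h =>
          hne (monomialValue_eq_zero_iff.2 ⟨j, hj, h⟩)
        obtain ⟨k, -, hk⟩ := Finset.exists_ne_zero_of_sum_ne_zero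
          (show ∑ k, B j k * star (z k) ≠ 0 from hj0)
        refine ⟨k, fun _ => ⟨fun h0 => hk ?_, hB j k fun h0 => hk ?_⟩⟩
        · simp [h0]
        · simp [h0]
      · exact ⟨j, fun h => absurd h hj⟩
    choose k hk using hex
    let P : Fin n →₀ ℕ := ∑ j ∈ Q.support, Finsupp.single (k j) (Q j)
    have hP1 : monomialValue μ P = 1 := by
      have h1 : star (monomialValue μ P) * monomialValue μ Q = 1 := by
        have hQ' : monomialValue μ Q = ∏ j ∈ Q.support, μ j ^ Q j :=
          (Finsupp.prod_fintype Q (fun j e => μ j ^ e) (by simp)).symm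
        rw [hQ', monomialValue_sum, star_prod, ← Finset.prod_mul_distrib]
        refine Finset.prod_eq_one fun j hj => ?_
        rw [monomialValue_single, star_pow, ← mul_pow, mul_comm, (hk j hj).2, one_pow]
      rw [hQ, mul_one] at h1
      simpa using congrArg star h1
    have hPS : P.support ⊆ Finset.univ.filter fun j => z j ≠ 0 := by
      intro i hi
      obtain ⟨j, hj, hji⟩ := Finset.exists_ne_zero_of_sum_ne_zero (by
        simpa [P, Finsupp.finsetSum_apply] using hi :
          ∑ j ∈ Q.support, (Finsupp.single (k j) (Q j)) i ≠ 0)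
      have : k j = i := by
        by_contra h
        exact hji (Finsupp.single_eq_of_ne (Ne.symm h))
      exact Finset.mem_filter.2 ⟨Finset.mem_univ _, this ▸ (hk j hj).1⟩
    have hP0 := eq_zero_of_mem_closure_of_support hS (hgen P hP1) hPS
    obtain ⟨j, hj⟩ := Finsupp.support_nonempty_iff.2 hQ0
    have hsum := (Finset.sum_eq_zero_iff.1 
      (show ∑ j ∈ Q.support, Finsupp.single (k j) (Q j) = 0 from hP0)) j hj
    exact (Finsupp.mem_support_iff.1 hj) (Finsupp.single_eq_zero.1 hsum)
  refine ⟨fun j hj => ?_, fun i => key _ (hR0 i) (hR i)⟩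
  have := key (Finsupp.single j 1) (by simp) (by rw [monomialValue_single, hl j hj, one_pow])
  simpa [monomialValue_single] using this

end ResonantLocus

/-! ### Linearization of the reflections -/

/-- A map with strict derivative the identity is injective near the point. -/
theorem HasStrictFDerivAt.eventually_injective_of_id {E : Type*} [NormedAddCommGroup E]
    [NormedSpace ℂ E] {Φ : E → E} {x : E}
    (h : HasStrictFDerivAt Φ (ContinuousLinearMap.id ℂ E) x) :
    ∀ᶠ p in 𝓝 (x, x), Φ p.1 = Φ p.2 → p.1 = p.2 := by
  filter_upwards [h.isLittleO.def (show (0 : ℝ) < 1 / 2 by norm_num)] with p hp heq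
  rw [heq, sub_self, zero_sub, norm_neg, ContinuousLinearMap.id_apply] at hp
  have := norm_nonneg (p.1 - p.2)
  exact sub_eq_zero.1 (norm_eq_zero.1 (by linarith))

/-- A pair of antiholomorphic involutions with diagonal product is linearized on the resonant locus
by a linearization of the product: conjugating it by one of the involutions and by its linear part
gives another linearization, which has to be the same one. -/
theorem exists_simultaneous_linearization {n p : ℕ}
    (ρ : Fin 2 → (Fin n → ℂ) → (Fin n → ℂ)) (hρ0 : ∀ i, ρ i 0 = 0)
    (hρan : ∀ i, AnalyticAt ℂ (fun z => ρ i (star z)) 0)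
    (hρinv : ∀ i, ∀ᶠ z in 𝓝 (0 : Fin n → ℂ), ρ i (ρ i z) = z)
    (μ : Fin n → ℂ) (hμ : linearPart (ρ 0 ∘ ρ 1) = Matrix.diagonal μ)
    (l : ℕ) (hl : ∀ j : Fin n, (j : ℕ) < l → μ j = 1)
    (R : Fin p → Fin n →₀ ℕ) (hR0 : ∀ i, R i ≠ 0) (hR : ∀ i, monomialValue μ (R i) = 1)
    (hgen : ∀ Q : Fin n →₀ ℕ, monomialValue μ Q = 1 →
      Q ∈ AddSubmonoid.closure
        ({P | ∃ j : Fin n, (j : ℕ) < l ∧ P = Finsupp.single j 1} ∪ Set.range R))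
    (hres : ∀ (Q : Fin n →₀ ℕ) (j : Fin n), 2 ≤ Q.degree → monomialValue μ Q = μ j →
      MvPolynomial.monomial Q (1 : ℂ) ∈ resonantIdeal l R)
    (hdio : IsDiophantineOn μ (resonantIdeal l R)) :
    ∃ Φ : (Fin n → ℂ) → (Fin n → ℂ),
      AnalyticAt ℂ Φ 0 ∧ Φ 0 = 0 ∧ fderiv ℂ Φ 0 = ContinuousLinearMap.id ℂ (Fin n → ℂ) ∧
      ∀ i, ∀ᶠ z in 𝓝 (0 : Fin n → ℂ), z ∈ resonantLocus l R →
        ρ i (Φ (antiDeriv (ρ i) z)) = Φ z := by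
  let F : (Fin n → ℂ) → (Fin n → ℂ) := ρ 0 ∘ ρ 1
  have hρt : ∀ i, Tendsto (ρ i) (𝓝 0) (𝓝 0) := fun i => by
    simpa [hρ0 i] using (continuousAt_of_antiholomorphic (hρan i)).tendsto
  have hFan := AnalyticAt.antiholomorphic_comp_comp (hρan 0) (hρan 1) analyticAt_id (hρ0 1) rfl
  have hFa : AnalyticAt ℂ F 0 := hFan.1
  have hF0 : F 0 = 0 := by simp [F, hρ0]
  have hF1 : ∀ v, fderiv ℂ F 0 v = μ * v := by
    intro v
    have h : Matrix.toLin' (linearPart F) v = fderiv ℂ F 0 v := by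
      rw [linearPart, Matrix.toLin'_toMatrix']; rfl
    rw [← h, hμ, Matrix.toLin'_apply]
    ext j
    rw [Matrix.mulVec_diagonal]; rfl
  -- The identities satisfied by the antilinear parts.
  have hσF : ∀ v, μ * v = antiDeriv (ρ 0) (antiDeriv (ρ 1) v) := fun v => by
    have h : fderiv ℂ F 0 v = _ := hFan.2 v
    rw [← hF1, h, fderiv_id, ContinuousLinearMap.id_apply]
  have hσσ : ∀ i v, antiDeriv (ρ i) (antiDeriv (ρ i) v) = v := by
    intro i v
    have h := (AnalyticAt.antiholomorphic_comp_comp (hρan i) (hρan i) analyticAt_id (hρ0 i)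
      rfl).2 v
    have heq : (fun z => ρ i (id (ρ i z))) =ᶠ[𝓝 0] id := hρinv i
    rwa [heq.fderiv_eq, fderiv_id, ContinuousLinearMap.id_apply, eq_comm] at h
  have hσ : ∀ i v, μ * antiDeriv (ρ i) (μ * v) = antiDeriv (ρ i) v := by
    intro i v
    fin_cases i <;> simp [hσF, hσσ]
  have hFρ : ∀ i, ∀ᶠ z in 𝓝 (0 : Fin n → ℂ), F (ρ i (F z)) = ρ i z := by
    have h0 := (hρt 1).eventually (hρinv 0)
    intro i
    fin_cases i
    · filter_upwards [h0, hρinv 1] with z hz0 hz1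
      simp [F, hz0, hz1]
    · have h1 := ((hρt 0).comp (hρt 1)).eventually (hρinv 1)
      filter_upwards [h0, h1] with z hz0 hz1
      simp only [Function.comp_apply] at hz1
      simp [F, hz0, hz1]
  -- The entries of the antilinear parts link eigenvalues with their conjugate inverses.
  have hB : ∀ i j k, antiLinearPart (ρ i) j k ≠ 0 → μ j * star (μ k) = 1 := by
    intro i j k hjk
    have h := congrFun (hσ i (Pi.single k 1)) j
    have h1 : star (μ * Pi.single k 1) = Pi.single k (star (μ k)) := by
      ext j'
      by_cases hj' : j' = k
      · subst hj'; simp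
      · simp [Pi.single_eq_of_ne hj']
    have h2 : star (Pi.single k 1 : Fin n → ℂ) = Pi.single k 1 := by
      ext j'
      by_cases hj' : j' = k
      · subst hj'; simp
      · simp [Pi.single_eq_of_ne hj']
    rw [Pi.mul_apply, antiDeriv, antiDeriv, h1, h2, Matrix.mulVec_single, Matrix.mulVec_single] at h
    simp only [Pi.smul_apply, Matrix.col_apply, MulOpposite.op_one, one_smul, MulOpposite.op_star,
      MulOpposite.smul_eq_mul_unop] at h
    simp only [MulOpposite.unop_star, MulOpposite.unop_op] at h
    refine mul_left_cancel₀ hjk ?_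
    linear_combination h
  have hV : ∀ i, ∀ z ∈ resonantLocus l R, antiDeriv (ρ i) z ∈ resonantLocus l R := fun i z hz =>
    mulVec_star_mem_resonantLocus (hB i) hl hR0 hR hgen hz
  -- A zero eigenvalue would make the `j`-th coordinate of `σ₁ = D σ₁ D`, a bijection, vanish.
  have hμ0 : ∀ j, μ j ≠ 0 := by
    intro j hj
    have h := congrFun (hσσ 0 (antiDeriv (ρ 1) (antiDeriv (ρ 1) (Pi.single j 1)))) j
    rw [← hσ 0, Pi.mul_apply, hj, zero_mul, hσσ, Pi.single_eq_same] at h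
    exact zero_ne_one h
  have hbound := hdio.brjunoBound hμ0 hres
  obtain ⟨Φ, hΦ, hΦ0, hΦ1, hΦlin⟩ := hbound.exists_linearization hFa hF0 hF1
  have hΦt : Tendsto Φ (𝓝 0) (𝓝 0) := by simpa [hΦ0] using hΦ.continuousAt.tendsto
  have hΦV : ∀ᶠ z in 𝓝 (0 : Fin n → ℂ), z ∈ resonantLocus l R → F (Φ z) = Φ (μ * z) :=
    eventually_resonantLocus hΦlin
  refine ⟨Φ, hΦ, hΦ0, hΦ1, fun i => ?_⟩
  have hσt : Tendsto (antiDeriv (ρ i)) (𝓝 0) (𝓝 0) := by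
    simpa [antiDeriv_zero] using
      (continuousAt_of_antiholomorphic (analyticAt_antiDeriv_star (ρ i))).tendsto
  have hμt : Tendsto (fun z => μ * z) (𝓝 0) (𝓝 (0 : Fin n → ℂ)) := by
    have h := (ContinuousLinearMap.mul ℂ (Fin n → ℂ) μ).continuous.tendsto 0
    rw [map_zero] at h
    exact h
  obtain ⟨hΨ, hΨ1⟩ := AnalyticAt.antiholomorphic_comp_comp (hρan i)
    (analyticAt_antiDeriv_star (ρ i)) hΦ (antiDeriv_zero _) hΦ0
  have hΨlin : ∀ᶠ z in 𝓝 (0 : Fin n → ℂ), z ∈ resonantLocus l R →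
      F (ρ i (Φ (antiDeriv (ρ i) z))) = ρ i (Φ (antiDeriv (ρ i) (μ * z))) := by
    have hyt := hσt.comp hμt
    filter_upwards [hyt.eventually hΦV, (hΦt.comp hyt).eventually (hFρ i)] with z hz1 hz2 hz
    have hμz : μ * z ∈ resonantLocus l R := by
      refine mem_resonantLocus_of_support (mem_resonantLocus_iff.1 hz) fun j hj => ?_
      have : z j = 0 := by simpa using hj
      simp [this]
    have h1 := hz1 (hV i _ hμz)
    simp only [Function.comp_apply] at h1 hz2
    rw [← hσ i z, ← h1, hz2]
  refine eventually_resonantLocus fun S hS => ?_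
  refine eventually_eq_of_linearizations hFa hF1 hΨ ?_ hΦ hΦ0 ?_
    (fun m hm w hw => wordValue_ne_of_isLocusSupport hres hm w
      (hS.mono fun j hj => ?_)) ?_ (hΦlin S hS)
  · simp [antiDeriv_zero, hΦ0, hρ0]
  · ext1 v
    rw [hΨ1, hΦ1, ContinuousLinearMap.id_apply, antiDeriv_antiDeriv, hσσ,
      ContinuousLinearMap.id_apply]
  · obtain ⟨i, -, rfl⟩ := Finset.mem_image.1 hj
    exact hw i
  · exact hΨlin.mono fun z hz hzS => hz (mem_resonantLocus_of_support hS hzS)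

end

theorem mainTheorem9 {n : ℕ}
    -- the two manifolds, their tangent spaces at the origin, and their reflections
    (M : Fin 2 → Set (Fin n → ℂ)) (T : Fin 2 → Submodule ℝ (Fin n → ℂ))
    (hM : ∀ i, IsTotallyRealGerm (M i) (T i))
    (hT : T 0 ⊔ T 1 ≠ ⊤)
    (ρ : Fin 2 → (Fin n → ℂ) → (Fin n → ℂ)) (hρ : ∀ i, IsReflection (M i) (ρ i))
    -- the linear part of `F = ρ₁ ∘ ρ₂` is diagonal, and its first `l` eigenvalues are `1`
    (μ : Fin n → ℂ) (hμ : linearPart (ρ 0 ∘ ρ 1) = Matrix.diagonal μ)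
    (l : ℕ) (hln : l ≤ n) (hl : ∀ j : Fin n, (j : ℕ) < l → μ j = 1)
    -- the other generators of the resonance relations
    {p : ℕ} (R : Fin p → Fin n →₀ ℕ) (hRdeg : ∀ i, 1 < (R i).degree)
    (hR : ∀ i, monomialValue μ (R i) = 1)
    (hgen : ∀ Q : Fin n →₀ ℕ, monomialValue μ Q = 1 →
      Q ∈ AddSubmonoid.closure
        ({P | ∃ j : Fin n, (j : ℕ) < l ∧ P = Finsupp.single j 1} ∪ Set.range R))
    (hres : ∀ (Q : Fin n →₀ ℕ) (j : Fin n), 2 ≤ Q.degree → monomialValue μ Q = μ j →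
      MvPolynomial.monomial Q (1 : ℂ) ∈ resonantIdeal l R)
    (hdio : IsDiophantineOn μ (resonantIdeal l R)) :
    -- a holomorphic change of coordinates, tangent to the identity
    ∃ Φ : (Fin n → ℂ) → (Fin n → ℂ),
      AnalyticAt ℂ Φ 0 ∧ Φ 0 = 0 ∧ fderiv ℂ Φ 0 = ContinuousLinearMap.id ℂ (Fin n → ℂ) ∧
      ∀ i, ∀ᶠ z in 𝓝 (0 : Fin n → ℂ), z ∈ resonantLocus l R →
        (Φ z ∈ M i ↔ (antiLinearPart (ρ i)).mulVec (star z) = z) := by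
  have hR0 : ∀ i, R i ≠ 0 := fun i h => by
    have := hRdeg i
    simp [h] at this
  obtain ⟨Φ, hΦ, hΦ0, hΦ1, hlin⟩ := exists_simultaneous_linearization ρ (fun i => (hρ i).map_zero)
    (fun i => (hρ i).antiholomorphic) (fun i => (hρ i).involutive) μ hμ l hl R hR0 hR hgen hres hdio
  refine ⟨Φ, hΦ, hΦ0, hΦ1, fun i => ?_⟩
  have hσt : Tendsto (antiDeriv (ρ i)) (𝓝 0) (𝓝 0) := by
    simpa [antiDeriv_zero] using
      (continuousAt_of_antiholomorphic (analyticAt_antiDeriv_star (ρ i))).tendsto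
  have hΦt : Tendsto Φ (𝓝 0) (𝓝 0) := by simpa [hΦ0] using hΦ.continuousAt.tendsto
  have hinj : ∀ᶠ z in 𝓝 (0 : Fin n → ℂ), Φ (antiDeriv (ρ i) z) = Φ z → antiDeriv (ρ i) z = z := by
    have hs : HasStrictFDerivAt Φ (ContinuousLinearMap.id ℂ (Fin n → ℂ)) 0 :=
      hΦ1 ▸ hΦ.hasStrictFDerivAt
    exact (hσt.prodMk_nhds tendsto_id).eventually hs.eventually_injective_of_id
  filter_upwards [hlin i, hinj, hΦt.eventually (hρ i).fixed, hΦt.eventually (hρ i).involutive,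
    (hΦt.comp hσt).eventually (hρ i).involutive] with z hz hzinj hfix hinv hinv' hzV
  rw [← hfix]
  change _ ↔ antiDeriv (ρ i) z = z
  refine ⟨fun h => hzinj ?_, fun h => ?_⟩
  · have h1 : ρ i (Φ (antiDeriv (ρ i) z)) = ρ i (Φ z) := (hz hzV).trans h.symm
    have h2 := congrArg (ρ i) h1
    rwa [hinv, show ρ i (ρ i (Φ (antiDeriv (ρ i) z))) = _ from hinv'] at h2
  · have h1 := hz hzV
    rwa [h] at h1
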